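/- **Setting.** There are $K\ge 2$ arms whose rewards $(R_1,\dots,R_K)\in[0,1]^K$ have an unknown joint law. Write $\mu_k=\mathbb E[R_k]$, and let $k^*$ be the unique arm with the largest mean. The player knows pseudo-rewards $s_{\ell,k}:[0,1]\to[0,1]$ (measurable) with $\mathbb E[R_\ell\mid R_k=r]\le s_{\ell,k}(r)$ and $s_{k,k}(r)=r$. Let $\phi_{\ell,k}=\mathbb E[s_{\ell,k}(R_k)]$, let $\mu_{k^{(2)}}=\max_{k\ne k^*}\mu_k$, $\Delta_k=\mu_{k^*}-\mu_k$ for $k\neq k^*$ and $\Delta_{k^*}=\min_{k\ne k^*}\Delta_k$. Arm $\ell$ is competitive, $\ell\in\mathcal C$, if its pseudo-gap $\mu_{k^{(2)}}-\phi_{\ell,k^*}$ is $\le 0$. Let $B(n,\delta)$ be an anytime confidence bound: for all $\delta\in(0,1)$ and i.i.d. $[0,1]$-valued variables with mean $\mu$ and empirical means $\hat\mu_n$, each of the events $\{\exists n\ge1:\hat\mu_n>\mu+B(n,\delta)\}$ and $\{\exists n\ge1:\hat\mu_n<\mu-B(n,\delta)\}$ has probability at most $\delta/2$. Assume $B(n,\delta)\le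 c\sqrt{\log(\log(n)/\delta)/n}$ for all $n\ge3$, $\delta\in(0,1)$. **Algorithm (C-LUCB), $\delta\in(0,1)$.** After $t$ rounds let $n_k(t)$ be the number of samples of arm $k$, and let $\hat\phi_{\ell,k}(t)$ be the average of $s_{\ell,k}(r)$ over the rewards $r$ observed from arm $k$, so that $\hat\mu_k=\hat\phi_{k,k}$. Put $\tilde U_{\ell,k}=\hat\phi_{\ell,k}+B(n_k,\tfrac{\delta}{2K})$, $\tilde U_\ell=\min_k\tilde U_{\ell,k}$, $L_k=\hat\mu_k-B(n_k,\tfrac{\delta}{2K})$, $I_{\ell,k}=\hat\phi_{\ell,k}+\sqrt{2\log t/n_k}$, $I_\ell=\min_kI_{\ell,k}$, where $\tilde U_{\ell,k}=I_{\ell,k}=+\infty$ and $L_k=-\infty$ if $n_k=0$. Initially all arms are active, $\mathcal A=\{1,\dots,K\}$. Round $t$ samples $m_1=\arg\max_{k\in\mathcal A}I_k$ and $m_2=\arg\max_{k\in\mathcal A\setminus\{m_1\}}\min(\tilde U_{k,k},I_k)$, with $I$ computed at index $t$ and all indices computed from the samples of the previous rounds; ties are broken arbitrarily. It then updates the statistics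 and removes from $\mathcal A$ every arm $k$ with $\tilde U_k<\max_{\ell\in\mathcal A}L_\ell$. The algorithm stops when at most one arm is active. Let $N$ be the total number of samples drawn (two per round). **Good event.** $\mathcal E$ is the event that at all times $t\ge1$ and for all arms $k,\ell$: $L_k\le\mu_k\le\tilde U_{k,k}$, $\ \phi_{k^*,\ell}\le\tilde U_{k^*,\ell}$ and $\phi_{\ell,k^*}\le\tilde U_{\ell,k^*}$. **Theorem 2.** There is a constant $\zeta>0$, depending only on the constant $c$ of the confidence bound, such that in every such problem and for every $\delta\in(0,1)$ one has $\Pr(\mathcal E)>0$ and $$\mathbb E[N\mid\mathcal E]\le\sum_{k\in\mathcal C}\frac{2\zeta}{\Delta_k^2}\log\left(\frac{2K\max\{1,\log(1/\Delta_k^2)\}}{\delta}\right)+\frac{3K+2Kt_0}{1-\delta}+\frac{2}{1-\delta}\left(\frac{(K+1)^3}{t_0}+\frac{2}{t_0^2}\right),$$ where $t_0=\inf\{\tau\ge2:\ \Delta_{k^*}\ge4\sqrt{2K\log\tau/\tau}\ \ \forall k\notin\mathcal C\}$. (The maximum equals $\log(1/\Delta_k^2)$ whenever $\Delta_k\le e^{-1/2}$.)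 Thus only the competitive arms contribute terms in $\log(1/\delta)$. -/

import Mathlib

open MeasureTheory ProbabilityTheory

/-- `B n δ` is a `1 - δ` anytime confidence bound for the mean of `[0,1]`-valued i.i.d. rewards:
uniformly over all sample sizes `n ≥ 1`, the empirical mean overshoots the mean by more than
`B n δ` with probability at most `δ / 2`, and undershoots it with probability at most `δ / 2`
(so the two-sided failure probability is at most `δ`).
The i.i.d. sequence is the canonical one, with law the infinite product of `ρ`. -/
def IsAnytimeBound (B : ℕ → ℝ → ℝ) : Prop :=
  ∀ (ρ : Measure ℝ) [IsProbabilityMeasure ρ], (∀ᵐ y ∂ρ, y ∈ Set.Icc (0 : ℝ) 1) →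
    ∀ δ : ℝ, 0 < δ → δ < 1 →
      Measure.infinitePi (fun _ : ℕ => ρ)
          {x | ∃ n : ℕ, 1 ≤ n ∧ (∫ y, y ∂ρ) + B n δ < (∑ i ∈ Finset.range n, x i) / n}
        ≤ ENNReal.ofReal (δ / 2) ∧
      Measure.infinitePi (fun _ : ℕ => ρ)
          {x | ∃ n : ℕ, 1 ≤ n ∧ (∑ i ∈ Finset.range n, x i) / n < (∫ y, y ∂ρ) - B n δ}
        ≤ ENNReal.ofReal (δ / 2)

/-- The width of the confidence bound is of order `√(log (log n / δ) / n)`, with constant `c`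
(for `n ≥ 3`, so that `log n > 1`). -/
def HasLILRate (c : ℝ) (B : ℕ → ℝ → ℝ) : Prop :=
  ∀ (n : ℕ) (δ : ℝ), 3 ≤ n → 0 < δ → δ < 1 →
    B n δ ≤ c * √(Real.log (Real.log n / δ) / n)

namespace CorrBandit

section Model

variable {K : ℕ}

/-- Rewards in `[0,1]` with joint law `ν`, and pseudo-rewards `s ℓ k r` in `[0,1]`:
`E[R_ℓ | R_k] ≤ s_{ℓ,k}(R_k)` almost surely, and `s_{k,k}(r) = r`. -/
structure IsModel (ν : Measure (Fin K → ℝ)) (s : Fin K → Fin K → ℝ → ℝ) : Prop where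
  reward_mem : ∀ᵐ x ∂ν, ∀ k, x k ∈ Set.Icc (0 : ℝ) 1
  measurable : ∀ ℓ k, Measurable (s ℓ k)
  pseudo_mem : ∀ ℓ k, ∀ r ∈ Set.Icc (0 : ℝ) 1, s ℓ k r ∈ Set.Icc (0 : ℝ) 1
  pseudo_self : ∀ k, ∀ r ∈ Set.Icc (0 : ℝ) 1, s k k r = r
  condExp_le : ∀ ℓ k,
    ν[(fun x : Fin K → ℝ => x ℓ) |
        MeasurableSpace.comap (fun x : Fin K → ℝ => x k) inferInstance]
      ≤ᵐ[ν] fun x => s ℓ k (x k)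

/-- Mean reward `μ_k`. -/
noncomputable def mean (ν : Measure (Fin K → ℝ)) (k : Fin K) : ℝ := ∫ x, x k ∂ν

/-- Expected pseudo-reward `φ_{ℓ,k}` of arm `ℓ` with respect to arm `k`. -/
noncomputable def pseudoMean (ν : Measure (Fin K → ℝ)) (s : Fin K → Fin K → ℝ → ℝ)
    (ℓ k : Fin K) : ℝ := ∫ x, s ℓ k (x k) ∂ν

/-- `ks` is the unique best arm. -/
def IsBest (ν : Measure (Fin K → ℝ)) (ks : Fin K) : Prop :=
  ∀ k, k ≠ ks → mean ν k < mean ν ks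

/-- The mean reward of the second best arm. -/
noncomputable def secondMean (ν : Measure (Fin K → ℝ)) (ks : Fin K) : ℝ :=
  ⨆ k : {k : Fin K // k ≠ ks}, mean ν k

/-- The gaps: `Δ_k = μ_{k*} - μ_k` for `k ≠ k*`, and `Δ_{k*} = min_{k ≠ k*} Δ_k`. -/
noncomputable def gap (ν : Measure (Fin K → ℝ)) (ks k : Fin K) : ℝ :=
  if k = ks then ⨅ j : {j : Fin K // j ≠ ks}, (mean ν ks - mean ν j)
  else mean ν ks - mean ν k

/-- The pseudo-gap of arm `ℓ`. -/
noncomputable def pseudoGap (ν : Measure (Fin K → ℝ)) (s : Fin K → Fin K → ℝ → ℝ)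
    (ks ℓ : Fin K) : ℝ := secondMean ν ks - pseudoMean ν s ℓ ks

open Classical in
/-- The set of competitive arms. -/
noncomputable def competitive (ν : Measure (Fin K → ℝ)) (s : Fin K → Fin K → ℝ → ℝ)
    (ks : Fin K) : Finset (Fin K) :=
  Finset.univ.filter fun ℓ => pseudoGap ν s ks ℓ ≤ 0

/-- The threshold `t₀`. -/
noncomputable def tZero (ν : Measure (Fin K → ℝ)) (s : Fin K → Fin K → ℝ → ℝ)
    (ks : Fin K) : ℝ :=
  sInf {τ : ℝ | 2 ≤ τ ∧ ∀ k, k ∉ competitive ν s ks →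
    4 * √(2 * K * Real.log τ / τ) ≤ gap ν ks ks}

end Model

section Algorithm

/-- What the algorithm remembers after some number of rounds: the active arms, the number `n k` of
samples of each arm, and the sums `S ℓ k` of the pseudo-rewards `s_{ℓ,k}(r)` over the rewards `r`
observed from arm `k`. -/
structure State (K : ℕ) where
  active : Finset (Fin K)
  n : Fin K → ℕ
  S : Fin K → Fin K → ℝ

variable {K : ℕ}

/-- Empirical pseudo-reward of arm `ℓ` with respect to arm `k` (for `ℓ = k`, the empirical mean of
arm `k`). Only used when `k` has been sampled. -/
noncomputable def State.pseudoAvg (σ : State K) (ℓ k : Fin K) : ℝ := σ.S ℓ k / σ.n k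

/-- CrossUCB index of arm `ℓ` with respect to arm `k`; infinite if `k` has not been sampled. -/
noncomputable def State.crossUCB (σ : State K) (B : ℕ → ℝ → ℝ) (δ : ℝ) (ℓ k : Fin K) : EReal :=
  if σ.n k = 0 then ⊤ else ((σ.pseudoAvg ℓ k + B (σ.n k) δ : ℝ) : EReal)

/-- The tightest CrossUCB index of arm `ℓ`. -/
noncomputable def State.crossUCBMin (σ : State K) (B : ℕ → ℝ → ℝ) (δ : ℝ) (ℓ : Fin K) : EReal :=
  ⨅ k, σ.crossUCB B δ ℓ k

/-- LCB index of arm `k`; `-∞` if `k` has not been sampled. -/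
noncomputable def State.lcb (σ : State K) (B : ℕ → ℝ → ℝ) (δ : ℝ) (k : Fin K) : EReal :=
  if σ.n k = 0 then ⊥ else ((σ.pseudoAvg k k - B (σ.n k) δ : ℝ) : EReal)

/-- PseudoUCB index of arm `ℓ` with respect to arm `k` at round `t`; infinite if `k` has not been
sampled. -/
noncomputable def State.pseudoUCB (σ : State K) (t : ℕ) (ℓ k : Fin K) : EReal :=
  if σ.n k = 0 then ⊤
  else ((σ.pseudoAvg ℓ k + √(2 * Real.log t / σ.n k) : ℝ) : EReal)

/-- The tightest PseudoUCB index of arm `ℓ` at round `t`. -/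
noncomputable def State.pseudoUCBMin (σ : State K) (t : ℕ) (ℓ : Fin K) : EReal :=
  ⨅ k, σ.pseudoUCB t ℓ k

/-- The algorithm plays another round as long as at least two arms are active. -/
def State.Running (σ : State K) : Prop := 2 ≤ σ.active.card

/-- The sampling rule at round `t` with parameter `δ`: `m.1` maximizes the PseudoUCB index over the
active arms, and `m.2` maximizes `min (Ũ_{k,k}(δ/2K)) I_k` over the other active arms.
Ties are broken arbitrarily. -/
def State.IsChoice (σ : State K) (B : ℕ → ℝ → ℝ) (δ : ℝ) (t : ℕ) (m : Fin K × Fin K) : Prop :=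
  (m.1 ∈ σ.active ∧ ∀ k ∈ σ.active, σ.pseudoUCBMin t k ≤ σ.pseudoUCBMin t m.1) ∧
  (m.2 ∈ σ.active.erase m.1 ∧ ∀ k ∈ σ.active.erase m.1,
    min (σ.crossUCB B (δ / (2 * K)) k k) (σ.pseudoUCBMin t k) ≤
      min (σ.crossUCB B (δ / (2 * K)) m.2 m.2) (σ.pseudoUCBMin t m.2))

/-- Initially all arms are active and nothing has been sampled. -/
def State.init (K : ℕ) : State K := ⟨Finset.univ, fun _ => 0, fun _ _ => 0⟩

/-- Record the reward `r` observed from arm `a`. -/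
noncomputable def State.observe (σ : State K) (s : Fin K → Fin K → ℝ → ℝ) (a : Fin K) (r : ℝ) :
    State K :=
  ⟨σ.active,
   fun k => if k = a then σ.n k + 1 else σ.n k,
   fun ℓ k => if k = a then σ.S ℓ k + s ℓ k r else σ.S ℓ k⟩

open Classical in
/-- Remove the active arms `k` with `Ũ_k(δ/2K) < max_{ℓ active} L_ℓ(δ/2K)`. -/
noncomputable def State.eliminate (σ : State K) (B : ℕ → ℝ → ℝ) (δ : ℝ) : State K :=
  ⟨σ.active.filter fun k =>
      ¬ σ.crossUCBMin B (δ / (2 * K)) k < σ.active.sup (σ.lcb B (δ / (2 * K))),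
   σ.n, σ.S⟩

open Classical in
/-- One round: unless the algorithm has stopped, sample the arms `m.1` and `m.2` (with reward
vectors `x` and `y`), then eliminate arms. -/
noncomputable def State.step (σ : State K) (s : Fin K → Fin K → ℝ → ℝ) (B : ℕ → ℝ → ℝ) (δ : ℝ)
    (m : Fin K × Fin K) (x y : Fin K → ℝ) : State K :=
  if σ.Running then ((σ.observe s m.1 (x m.1)).observe s m.2 (y m.2)).eliminate B δ else σ

/-- The state after `t` rounds. The arms `m i` and the reward vectors `x i`, `y i` are those of
round `i + 1`. -/
noncomputable def stateAfter (s : Fin K → Fin K → ℝ → ℝ) (B : ℕ → ℝ → ℝ) (δ : ℝ)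
    (m : ℕ → Fin K × Fin K) (x y : ℕ → Fin K → ℝ) : ℕ → State K
  | 0 => State.init K
  | t + 1 => (stateAfter s B δ m x y t).step s B δ (m t) (x t) (y t)

variable {Ω : Type*} [mΩ : MeasurableSpace Ω]

/-- The random state after `t` rounds. -/
noncomputable def randState (s : Fin K → Fin K → ℝ → ℝ) (B : ℕ → ℝ → ℝ) (δ : ℝ)
    (m : ℕ → Ω → Fin K × Fin K) (X Y : ℕ → Ω → Fin K → ℝ) (t : ℕ) (ω : Ω) : State K :=
  stateAfter s B δ (fun i => m i ω) (fun i => X i ω) (fun i => Y i ω) t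

/-- A run of C-LUCB. The reward vectors `X t`, `Y t` from which the first and the second sample of
round `t + 1` are read have law `ν` and are independent of the past `ℱ t`; nothing is assumed on
their joint law, so the two samples of a round may come from one realization of the rewards
or from independent ones. The arms of round `t + 1` are determined by the past `ℱ t`
(which may contain extra randomness for breaking ties) and obey the sampling rule. -/
structure IsCLUCBRun (ν : Measure (Fin K → ℝ)) (s : Fin K → Fin K → ℝ → ℝ) (B : ℕ → ℝ → ℝ)
    (δ : ℝ) (P : Measure Ω) (ℱ : Filtration ℕ mΩ)
    (m : ℕ → Ω → Fin K × Fin K) (X Y : ℕ → Ω → Fin K → ℝ) : Prop where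
  measurable_X : ∀ t, Measurable[ℱ (t + 1)] (X t)
  measurable_Y : ∀ t, Measurable[ℱ (t + 1)] (Y t)
  law_X : ∀ t, P.map (X t) = ν
  law_Y : ∀ t, P.map (Y t) = ν
  indep_X : ∀ t, Indep (MeasurableSpace.comap (X t) inferInstance) (ℱ t) P
  indep_Y : ∀ t, Indep (MeasurableSpace.comap (Y t) inferInstance) (ℱ t) P
  measurable_arms : ∀ t, Measurable[ℱ t] (m t)
  choice : ∀ t ω, (randState s B δ m X Y t ω).Running →
    (randState s B δ m X Y t ω).IsChoice B δ (t + 1) (m t ω)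

/-- The total number of samples: two for every round that is played. -/
noncomputable def numSamples (s : Fin K → Fin K → ℝ → ℝ) (B : ℕ → ℝ → ℝ) (δ : ℝ)
    (m : ℕ → Ω → Fin K × Fin K) (X Y : ℕ → Ω → Fin K → ℝ) (ω : Ω) : ENNReal :=
  ∑' t : ℕ, {t : ℕ | (randState s B δ m X Y t ω).Running}.indicator (fun _ => 2) t

/-- `ℰ₁`: all means lie in their confidence intervals at all times. -/
def event1 (ν : Measure (Fin K → ℝ)) (s : Fin K → Fin K → ℝ → ℝ) (B : ℕ → ℝ → ℝ) (δ : ℝ)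
    (m : ℕ → Ω → Fin K × Fin K) (X Y : ℕ → Ω → Fin K → ℝ) : Set Ω :=
  {ω | ∀ t : ℕ, 1 ≤ t → ∀ k,
    (randState s B δ m X Y t ω).lcb B (δ / (2 * K)) k ≤ (mean ν k : EReal) ∧
    (mean ν k : EReal) ≤ (randState s B δ m X Y t ω).crossUCB B (δ / (2 * K)) k k}

/-- `ℰ₂`: the expected pseudo-rewards of the best arm `ks` with respect to all arms lie below the
CrossUCB indices at all times. -/
def event2 (ν : Measure (Fin K → ℝ)) (s : Fin K → Fin K → ℝ → ℝ) (B : ℕ → ℝ → ℝ) (δ : ℝ)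
    (ks : Fin K) (m : ℕ → Ω → Fin K × Fin K) (X Y : ℕ → Ω → Fin K → ℝ) : Set Ω :=
  {ω | ∀ t : ℕ, 1 ≤ t → ∀ ℓ,
    (pseudoMean ν s ks ℓ : EReal) ≤
      (randState s B δ m X Y t ω).crossUCB B (δ / (2 * K)) ks ℓ}

/-- `ℰ₃`: the expected pseudo-rewards of all arms with respect to the best arm `ks` lie below the
CrossUCB indices at all times. -/
def event3 (ν : Measure (Fin K → ℝ)) (s : Fin K → Fin K → ℝ → ℝ) (B : ℕ → ℝ → ℝ) (δ : ℝ)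
    (ks : Fin K) (m : ℕ → Ω → Fin K × Fin K) (X Y : ℕ → Ω → Fin K → ℝ) : Set Ω :=
  {ω | ∀ t : ℕ, 1 ≤ t → ∀ ℓ,
    (pseudoMean ν s ℓ ks : EReal) ≤
      (randState s B δ m X Y t ω).crossUCB B (δ / (2 * K)) ℓ ks}

/-- The good event `ℰ = ℰ₁ ∩ ℰ₂ ∩ ℰ₃`. -/
def goodEvent (ν : Measure (Fin K → ℝ)) (s : Fin K → Fin K → ℝ → ℝ) (B : ℕ → ℝ → ℝ) (δ : ℝ)
    (ks : Fin K) (m : ℕ → Ω → Fin K × Fin K) (X Y : ℕ → Ω → Fin K → ℝ) : Set Ω :=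
  event1 ν s B δ m X Y ∩ event2 ν s B δ ks m X Y ∩ event3 ν s B δ ks m X Y

end Algorithm

end CorrBandit

/-!
Two facts carry the proof: samples of an arm behave like i.i.d. samples although the rounds in which
the arm is sampled depend on the past, and on the good event all but a few rounds sample a
competitive arm that has not been sampled often yet.

**Probability.** For a family of target sets, the probability that an i.i.d. random walk started at
`(n, z)` ever hits it (`hitProb`) is a superharmonic function. Along the number and the sum of the
samples of an arm it is therefore a supermartingale, stopped here at the hitting time, so a statement
about all pairs (number, sum) of an arm fails with at most its i.i.d. probability
(`measure_exists_hit_le`, `IsCLUCBRun.measure_exists_sum_mem_le`). Applied to the anytime bound `B`,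
a union bound over `4 K` one-sided statements at level `δ / (2 K)` gives the good event probability at
least `1 - δ`. Applied to Hoeffding's inequality, the averages deviate from their means by more
than the PseudoUCB radius (`Deviates`) in at most `3 K` rounds in expectation, and a given average
exceeds its mean by `ε` at no more than `1 / (2 ε²)` sample sizes in expectation.

**Rounds.** On the good event the best arm stays active. Let `τ k` be of order
`log (K log (1 / Δ_k²) / δ) / Δ_k²`, so that the confidence width is at most `Δ_k / 8` after more
than `τ k` samples. In a round without deviations, one of the following holds
(`IsPath.round_cases`).
* A competitive arm with at most `τ k` samples is sampled. Each such arm accounts for at most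
  `τ k + 1` rounds.
* The best arm is sampled together with a non-competitive arm that has survived elimination although
  the best arm has more than `τ` samples. Then the pseudo-reward of that arm with respect to the best
  arm is off by half the smallest gap `Δ`; the expected number of such rounds is at most `2 / Δ²` per
  arm, which is small compared with `t₀`.
* The best arm is not sampled, and the second arm is non-competitive. By optimism of the PseudoUCB
  index the best arm then has few samples. In every earlier round either the best arm was sampled, or
  another arm with few samples, or there was a deviation; beyond `t₀` it follows that at least
  half as many rounds as have been played had deviations
  (`IsPath.succ_le_two_mul_card_deviates`). So there are at most `t₀` plus twice the number of
  deviating rounds of this kind.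

Adding up (`IsPath.card_running_le`) and taking expectations, the terms without `log (1 / δ)` are
at most `t₀ + 9 K` plus the `2 / Δ²` terms, which the claimed remainder dominates (`remainder_le`).
-/

/-! ### Optional skipping and Hoeffding's inequality -/

namespace CorrBandit

section IidSequences

/-- Prepend a value to a real sequence. -/
def consSeq (p : ℝ × (ℕ → ℝ)) : ℕ → ℝ
  | 0 => p.1
  | i + 1 => p.2 i

lemma measurable_consSeq : Measurable consSeq := by
  refine measurable_pi_lambda _ fun i => ?_
  cases i with
  | zero => exact measurable_fst
  | succ i => exact (measurable_pi_apply i).comp measurable_snd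

lemma map_consSeq_prod_infinitePi (ρ : Measure ℝ) [IsProbabilityMeasure ρ] :
    (ρ.prod (Measure.infinitePi fun _ : ℕ => ρ)).map consSeq =
      Measure.infinitePi fun _ : ℕ => ρ := by
  refine Measure.eq_infinitePi (μ := fun _ : ℕ => ρ) fun I u hu => ?_
  obtain ⟨n, hn⟩ : ∃ n, I ⊆ Finset.range (n + 1) :=
    ⟨I.sup id, fun i hi => Finset.mem_range.2 (Nat.lt_succ_of_le (Finset.le_sup (f := id) hi))⟩
  classical
  -- constraining the other coordinates trivially, one may replace `I` by an initial segment
  let v : ℕ → Set ℝ := fun i => if i ∈ I then u i else Set.univ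
  have hv : ∀ i, MeasurableSet (v i) := fun i => by
    by_cases h : i ∈ I <;> simp [v, h, hu i]
  have hpre : consSeq ⁻¹' Set.pi I u = v 0 ×ˢ Set.pi (Finset.range n) fun i => v (i + 1) := by
    ext p
    simp only [Set.mem_preimage, Set.mem_pi, Set.mem_prod, Finset.mem_coe, Finset.mem_range]
    constructor
    · intro h
      refine ⟨?_, fun i _ => ?_⟩
      · by_cases h0 : 0 ∈ I
        · simpa [v, h0, consSeq] using h 0 h0
        · simp [v, h0]
      · by_cases h0 : i + 1 ∈ I
        · simpa [v, h0, consSeq] using h (i + 1) h0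
        · simp [v, h0]
    · rintro ⟨h0, h1⟩ i hi
      cases i with
      | zero => simpa [v, hi, consSeq] using h0
      | succ i =>
        have := h1 i (by have := Finset.mem_range.1 (hn hi); omega)
        simpa [v, hi, consSeq] using this
  have hprod : ∏ i ∈ I, ρ (u i) = ∏ i ∈ Finset.range (n + 1), ρ (v i) := by
    rw [← Finset.prod_subset hn (f := fun i => ρ (v i)) fun i _ hi => by simp [v, hi]]
    exact Finset.prod_congr rfl fun i hi => by simp [v, hi]
  rw [Measure.map_apply measurable_consSeq
      (MeasurableSet.pi I.countable_toSet fun i _ => hu i), hpre, Measure.prod_prod,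
    Measure.infinitePi_pi _ fun i _ => hv (i + 1), hprod, Finset.prod_range_succ', mul_comm]

/-- The probability that a random walk with step law `ρ`, which after `n` steps is at `z`, is now or
later in the target set of its current time. -/
noncomputable def hitProb (ρ : Measure ℝ) [IsProbabilityMeasure ρ] (A : ℕ → Set ℝ) (n : ℕ) (z : ℝ) :
    ENNReal :=
  Measure.infinitePi (fun _ : ℕ => ρ) {x | ∃ j : ℕ, z + ∑ i ∈ Finset.range j, x i ∈ A (n + j)}

variable (ρ : Measure ℝ) [IsProbabilityMeasure ρ] {A : ℕ → Set ℝ}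

lemma measurable_hitProb (hA : ∀ n, MeasurableSet (A n)) (n : ℕ) :
    Measurable (hitProb ρ A n) := by
  have hs : MeasurableSet
      {p : ℝ × (ℕ → ℝ) | ∃ j : ℕ, p.1 + ∑ i ∈ Finset.range j, p.2 i ∈ A (n + j)} := by
    rw [Set.ofPred_exists]
    refine MeasurableSet.iUnion fun j => ?_
    have : Measurable fun p : ℝ × (ℕ → ℝ) => p.1 + ∑ i ∈ Finset.range j, p.2 i := by fun_prop
    exact this (hA _)
  exact measurable_measure_prodMk_left hs

lemma hitProb_eq_one {n : ℕ} {z : ℝ} (h : z ∈ A n) : hitProb ρ A n z = 1 := by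
  have : {x : ℕ → ℝ | ∃ j : ℕ, z + ∑ i ∈ Finset.range j, x i ∈ A (n + j)} = Set.univ :=
    Set.eq_univ_of_forall fun x => ⟨0, by simpa using h⟩
  rw [hitProb, this, measure_univ]

/-- The hitting probability is superharmonic: one more step cannot increase it on average. -/
lemma lintegral_hitProb_le (hA : ∀ n, MeasurableSet (A n)) (n : ℕ) (z : ℝ) :
    ∫⁻ y, hitProb ρ A (n + 1) (z + y) ∂ρ ≤ hitProb ρ A n z := by
  have hm : ∀ j, Measurable fun x : ℕ → ℝ => z + ∑ i ∈ Finset.range j, x i := fun j => by fun_prop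
  have hs : MeasurableSet
      {x : ℕ → ℝ | ∃ j : ℕ, z + ∑ i ∈ Finset.range (j + 1), x i ∈ A (n + 1 + j)} := by
    rw [Set.ofPred_exists]
    exact MeasurableSet.iUnion fun j => hm _ (hA _)
  calc ∫⁻ y, hitProb ρ A (n + 1) (z + y) ∂ρ
      = Measure.infinitePi (fun _ : ℕ => ρ)
          {x | ∃ j : ℕ, z + ∑ i ∈ Finset.range (j + 1), x i ∈ A (n + 1 + j)} := by
        conv_rhs => rw [← map_consSeq_prod_infinitePi ρ, Measure.map_apply measurable_consSeq hs,
          Measure.prod_apply (measurable_consSeq hs)]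
        refine lintegral_congr fun y => ?_
        rw [hitProb]
        congr 1
        ext x
        simp only [Set.mem_ofPred_eq, Set.mem_preimage, Finset.sum_range_succ', consSeq]
        refine exists_congr fun j => ?_
        rw [add_comm (∑ i ∈ Finset.range j, x i) y, ← add_assoc z]
    _ ≤ hitProb ρ A n z := by
        refine measure_mono ?_
        rintro x ⟨j, hj⟩
        exact ⟨j + 1, by rwa [← add_assoc, add_right_comm]⟩

end IidSequences

section OptionalSkipping

variable {Ω : Type*} [mΩ : MeasurableSpace Ω]

/-- Optional skipping. The pair `(N, S)` counts and sums samples which are taken at times chosen by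
looking at the past; `hstep` says that a superharmonic function of it does not increase on average.
Then the pair hits a family of target sets with at most the probability of an i.i.d. sequence. -/
lemma measure_exists_hit_le (P : Measure Ω) [IsProbabilityMeasure P] (ℱ : Filtration ℕ mΩ)
    (N : ℕ → Ω → ℕ) (S : ℕ → Ω → ℝ) (ρ : Measure ℝ) [IsProbabilityMeasure ρ]
    (hN : ∀ t, Measurable[ℱ t] (N t)) (hS : ∀ t, Measurable[ℱ t] (S t))
    (hN0 : ∀ ω, N 0 ω = 0) (hS0 : ∀ ω, S 0 ω = 0)
    (hstep : ∀ (t : ℕ) (h : ℕ → ℝ → ENNReal), (∀ n, Measurable (h n)) →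
      (∀ n z, ∫⁻ y, h (n + 1) (z + y) ∂ρ ≤ h n z) → ∀ F, MeasurableSet[ℱ t] F →
        ∫⁻ ω in F, h (N (t + 1) ω) (S (t + 1) ω) ∂P ≤ ∫⁻ ω in F, h (N t ω) (S t ω) ∂P)
    (A : ℕ → Set ℝ) (hA : ∀ n, MeasurableSet (A n)) :
    P {ω | ∃ t, S t ω ∈ A (N t ω)} ≤
      Measure.infinitePi (fun _ : ℕ => ρ) {x | ∃ n : ℕ, ∑ i ∈ Finset.range n, x i ∈ A n} := by
  have hpair : MeasurableSet {p : ℕ × ℝ | p.2 ∈ A p.1} := by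
    have : {p : ℕ × ℝ | p.2 ∈ A p.1} = ⋃ n, {n} ×ˢ A n := by
      ext ⟨n, z⟩; simp
    rw [this]
    exact MeasurableSet.iUnion fun n => (measurableSet_singleton n).prod (hA n)
  have hhit : ∀ t, MeasurableSet[ℱ t] {ω | S t ω ∈ A (N t ω)} := fun t =>
    ((hN t).prodMk (hS t)) hpair
  let H : ℕ → Set Ω := fun T => {ω | ∃ t ≤ T, S t ω ∈ A (N t ω)}
  have hH : ∀ T, MeasurableSet[ℱ T] (H T) := fun T => by
    have : H T = ⋃ t ∈ Finset.range (T + 1), {ω | S t ω ∈ A (N t ω)} := by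
      ext ω; simp [H]
    rw [this]
    refine Finset.measurableSet_biUnion _ fun t ht => ?_
    exact ℱ.mono (Nat.lt_succ_iff.1 (Finset.mem_range.1 ht)) _ (hhit t)
  let h := hitProb ρ A
  have hle : ∀ T (G : Set Ω), MeasurableSet G → (∀ ω ∈ G, S T ω ∈ A (N T ω)) →
      P G ≤ ∫⁻ ω in G, h (N T ω) (S T ω) ∂P := fun T G hG hGT => by
    rw [← setLIntegral_one]
    refine setLIntegral_mono' hG fun ω hω => ?_
    rw [show h (N T ω) (S T ω) = 1 from hitProb_eq_one ρ (hGT ω hω)]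
  have key : ∀ T, P (H T) + ∫⁻ ω in (H T)ᶜ, h (N T ω) (S T ω) ∂P ≤ h 0 0 := by
    intro T
    induction T with
    | zero =>
      have hm := ℱ.le 0 _ (hH 0)
      calc _ ≤ ∫⁻ ω in H 0, h (N 0 ω) (S 0 ω) ∂P + ∫⁻ ω in (H 0)ᶜ, h (N 0 ω) (S 0 ω) ∂P := by
            gcongr
            exact hle 0 _ hm (by rintro ω ⟨t, ht, h'⟩; obtain rfl := Nat.le_zero.1 ht; exact h')
        _ = h 0 0 := by
            rw [lintegral_add_compl _ hm]
            simp [hN0, hS0]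
    | succ T ih =>
      have hm := ℱ.le T _ (hH T)
      have hm' := ℱ.le (T + 1) _ (hH (T + 1))
      have hsub : H T ⊆ H (T + 1) := fun ω ⟨t, ht, h'⟩ => ⟨t, by omega, h'⟩
      have hdiff : (H T)ᶜ = (H (T + 1) \ H T) ∪ (H (T + 1))ᶜ := by
        ext ω
        have := @hsub ω
        simp only [Set.mem_compl_iff, Set.mem_union, Set.mem_sdiff]
        tauto
      calc _ ≤ (P (H T) + P (H (T + 1) \ H T)) +
              ∫⁻ ω in (H (T + 1))ᶜ, h (N (T + 1) ω) (S (T + 1) ω) ∂P := by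
            gcongr
            rw [← Set.union_sdiff_cancel hsub]
            simpa using measure_union_le (μ := P) (H T) (H (T + 1) \ H T)
        _ ≤ P (H T) + (∫⁻ ω in H (T + 1) \ H T, h (N (T + 1) ω) (S (T + 1) ω) ∂P +
              ∫⁻ ω in (H (T + 1))ᶜ, h (N (T + 1) ω) (S (T + 1) ω) ∂P) := by
            rw [add_assoc]
            gcongr
            refine hle (T + 1) _ (hm'.diff hm) ?_
            rintro ω ⟨⟨t, ht, h'⟩, hn⟩
            rcases Nat.le_succ_iff.1 ht with h1 | rfl
            · exact absurd ⟨t, h1, h'⟩ hn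
            · exact h'
        _ = P (H T) + ∫⁻ ω in (H T)ᶜ, h (N (T + 1) ω) (S (T + 1) ω) ∂P := by
            rw [hdiff, lintegral_union hm'.compl]
            exact Set.disjoint_left.2 fun ω h1 h2 => h2 h1.1
        _ ≤ P (H T) + ∫⁻ ω in (H T)ᶜ, h (N T ω) (S T ω) ∂P := by
            refine add_le_add le_rfl ?_
            exact hstep T h (measurable_hitProb ρ hA) (lintegral_hitProb_le ρ hA) _ (hH T).compl
        _ ≤ h 0 0 := ih
  have hU : {ω | ∃ t, S t ω ∈ A (N t ω)} = ⋃ T, H T := by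
    ext ω
    simp only [Set.mem_ofPred_eq, Set.mem_iUnion, H]
    exact ⟨fun ⟨t, ht⟩ => ⟨t, t, le_rfl, ht⟩, fun ⟨_, t, _, ht⟩ => ⟨t, ht⟩⟩
  have hmono : Monotone H := fun a b hab ω ⟨t, ht, h'⟩ => ⟨t, ht.trans hab, h'⟩
  rw [hU, hmono.measure_iUnion]
  refine iSup_le fun T => (le_self_add.trans (key T)).trans_eq ?_
  simp [h, hitProb]

end OptionalSkipping

/-- Integrating a function of the past and of an independent variable. -/
lemma lintegral_indep_eq {Ω E E' : Type*} [MeasurableSpace E] [MeasurableSpace E']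
    {m mΩ : MeasurableSpace Ω} (P : Measure Ω) [IsProbabilityMeasure P] (hm : m ≤ mΩ)
    {X : Ω → E} (hX : Measurable X) (hind : Indep (MeasurableSpace.comap X inferInstance) m P)
    {W : Ω → E'} (hW : Measurable[m] W) {Φ : E' → E → ENNReal}
    (hΦ : Measurable (Function.uncurry Φ)) :
    ∫⁻ ω, Φ (W ω) (X ω) ∂P = ∫⁻ ω, ∫⁻ x, Φ (W ω) x ∂(P.map X) ∂P := by
  have hW' : Measurable W := hW.mono hm le_rfl
  have hi : IndepFun W X P := by
    rw [IndepFun_iff_Indep]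
    exact (indep_of_indep_of_le_right hind hW.comap_le).symm
  have := Measure.isProbabilityMeasure_map (μ := P) hX.aemeasurable
  have hprod := (indepFun_iff_map_prod_eq_prod_map_map hW'.aemeasurable hX.aemeasurable).1 hi
  calc ∫⁻ ω, Φ (W ω) (X ω) ∂P
      = ∫⁻ p, Function.uncurry Φ p ∂(P.map fun ω => (W ω, X ω)) := by
        rw [lintegral_map hΦ (hW'.prodMk hX)]; rfl
    _ = ∫⁻ w, ∫⁻ x, Φ w x ∂(P.map X) ∂(P.map W) := by
        rw [hprod, lintegral_prod _ hΦ.aemeasurable]; rfl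
    _ = _ := by
        rw [lintegral_map _ hW']
        exact hΦ.lintegral_prod_right'

section Hoeffding

variable (ρ : Measure ℝ) [IsProbabilityMeasure ρ]

/-- Hoeffding's inequality for the sum of an i.i.d. sequence of functions of `[0,1]`-variables. -/
lemma infinitePi_sum_ge_le {f : ℝ → ℝ} (hf : Measurable f) {a b : ℝ} (hab : |b - a| = 1)
    (h : ∀ᵐ y ∂ρ, f y ∈ Set.Icc a b) (n : ℕ) {ε : ℝ} (hε : 0 ≤ ε) :
    Measure.infinitePi (fun _ : ℕ => ρ)
      {x | n * ε ≤ ∑ i ∈ Finset.range n, (f (x i) - ∫ y, f y ∂ρ)} ≤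
        ENNReal.ofReal (Real.exp (-(2 * n * ε ^ 2))) := by
  set μ := Measure.infinitePi (fun _ : ℕ => ρ)
  have hmp : ∀ i : ℕ, MeasurePreserving (fun x : ℕ → ℝ => x i) μ ρ := fun i =>
    measurePreserving_eval_infinitePi (fun _ : ℕ => ρ) i
  have hmean : ∀ i : ℕ, ∫ x, f (x i) ∂μ = ∫ y, f y ∂ρ := fun i => by
    rw [← (hmp i).map_eq, integral_map (hmp i).measurable.aemeasurable
      hf.aestronglyMeasurable]
  have hind : iIndepFun (fun (i : ℕ) (x : ℕ → ℝ) => f (x i) - ∫ y, f y ∂ρ) μ :=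
    iIndepFun_infinitePi (P := fun _ : ℕ => ρ) (X := fun _ y => f y - ∫ y, f y ∂ρ)
      fun _ => (hf.sub_const _)
  have hsub : ∀ i < n, HasSubgaussianMGF (fun x : ℕ → ℝ => f (x i) - ∫ y, f y ∂ρ)
      ((‖b - a‖₊ / 2) ^ 2) μ := fun i _ => by
    rw [← hmean i]
    exact hasSubgaussianMGF_of_mem_Icc (hf.comp (hmp i).measurable).aemeasurable
      ((hmp i).quasiMeasurePreserving.ae h)
  have := HasSubgaussianMGF.measure_sum_range_ge_le_of_iIndepFun hind hsub
    (mul_nonneg n.cast_nonneg hε)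
  rw [← ENNReal.ofReal_toReal (measure_ne_top μ _)]
  refine ENNReal.ofReal_le_ofReal (this.trans_eq ?_)
  congr 1
  have hn : ((‖b - a‖₊ : NNReal) : ℝ) = 1 := by simpa using hab
  rcases Nat.eq_zero_or_pos n with rfl | hpos
  · simp
  · have : (n : ℝ) ≠ 0 := by positivity
    push_cast
    push_cast at hn
    rw [hn]
    field_simp

lemma infinitePi_avg_ge_le (h : ∀ᵐ y ∂ρ, y ∈ Set.Icc (0 : ℝ) 1) {n : ℕ} (hn : 1 ≤ n) {ε : ℝ}
    (hε : 0 ≤ ε) :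
    Measure.infinitePi (fun _ : ℕ => ρ)
      {x | (∫ y, y ∂ρ) + ε ≤ (∑ i ∈ Finset.range n, x i) / n} ≤
        ENNReal.ofReal (Real.exp (-(2 * n * ε ^ 2))) := by
  refine le_trans (measure_mono fun x hx => ?_)
    (infinitePi_sum_ge_le ρ measurable_id (a := 0) (b := 1) (by simp) h n hε)
  have hn' : (0 : ℝ) < n := by exact_mod_cast hn
  simp only [Set.mem_ofPred_eq, le_div_iff₀ hn', id, Finset.sum_sub_distrib, Finset.sum_const,
    Finset.card_range, nsmul_eq_mul] at hx ⊢
  linarith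

lemma infinitePi_avg_le_le (h : ∀ᵐ y ∂ρ, y ∈ Set.Icc (0 : ℝ) 1) {n : ℕ} (hn : 1 ≤ n) {ε : ℝ}
    (hε : 0 ≤ ε) :
    Measure.infinitePi (fun _ : ℕ => ρ)
      {x | (∑ i ∈ Finset.range n, x i) / n ≤ (∫ y, y ∂ρ) - ε} ≤
        ENNReal.ofReal (Real.exp (-(2 * n * ε ^ 2))) := by
  refine le_trans (measure_mono fun x hx => ?_)
    (infinitePi_sum_ge_le ρ measurable_neg (a := -1) (b := 0) (by simp) ?_ n hε)
  · have hn' : (0 : ℝ) < n := by exact_mod_cast hn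
    simp only [Set.mem_ofPred_eq, div_le_iff₀ hn', Finset.sum_sub_distrib, Finset.sum_const,
      Finset.card_range, nsmul_eq_mul, Finset.sum_neg_distrib] at hx ⊢
    rw [integral_neg]
    linarith
  · filter_upwards [h] with y hy
    exact ⟨by linarith [hy.2], by linarith [hy.1]⟩

end Hoeffding

end CorrBandit

/-! ### Measurability of the states, and adaptively sampled arms -/

namespace CorrBandit

variable {K : ℕ}

section StateMeasurability

/-- A random state all of whose components are measurable. -/
structure MeasurableState {Ω : Type*} (mΩ : MeasurableSpace Ω) (σ : Ω → State K) : Prop where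
  active : ∀ k, MeasurableSet[mΩ] {ω | k ∈ (σ ω).active}
  n : ∀ k, Measurable[mΩ] fun ω => (σ ω).n k
  S : ∀ ℓ k, Measurable[mΩ] fun ω => (σ ω).S ℓ k

namespace MeasurableState

lemma mono {Ω : Type*} {m₁ m₂ : MeasurableSpace Ω} (h : m₁ ≤ m₂) {σ : Ω → State K}
    (hσ : MeasurableState m₁ σ) : MeasurableState m₂ σ :=
  ⟨fun k => h _ (hσ.active k), fun k => (hσ.n k).mono h le_rfl, fun ℓ k => (hσ.S ℓ k).mono h le_rfl⟩

variable {Ω : Type*} {mΩ : MeasurableSpace Ω} {σ : Ω → State K}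

lemma measurableSet_running (h : MeasurableState mΩ σ) : MeasurableSet {ω | (σ ω).Running} := by
  have : {ω | (σ ω).Running} = ⋃ A ∈ Finset.univ.filter (fun A : Finset (Fin K) => 2 ≤ A.card),
      {ω | (σ ω).active = A} := by
    ext ω; simp [State.Running]
  rw [this]
  refine Finset.measurableSet_biUnion _ fun A _ => ?_
  have : {ω | (σ ω).active = A} = ⋂ k, {ω | k ∈ (σ ω).active ↔ k ∈ A} := by
    ext ω; simp [Finset.ext_iff]
  rw [this]
  exact MeasurableSet.iInter fun k => (h.active k).iff (MeasurableSet.const _)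

lemma measurable_pseudoAvg (h : MeasurableState mΩ σ) (ℓ k : Fin K) :
    Measurable fun ω => (σ ω).pseudoAvg ℓ k :=
  (h.S ℓ k).div (measurable_from_nat.comp (h.n k) : Measurable fun ω => (((σ ω).n k : ℕ) : ℝ))

lemma measurableSet_unsampled (h : MeasurableState mΩ σ) (k : Fin K) :
    MeasurableSet {ω | (σ ω).n k = 0} := h.n k (measurableSet_singleton 0)

lemma measurable_crossUCB (h : MeasurableState mΩ σ) (B : ℕ → ℝ → ℝ) (δ : ℝ) (ℓ k : Fin K) :
    Measurable fun ω => (σ ω).crossUCB B δ ℓ k :=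
  Measurable.ite (h.measurableSet_unsampled k) measurable_const <| measurable_coe_real_ereal.comp <|
    (h.measurable_pseudoAvg ℓ k).add
      ((measurable_from_nat (f := fun n => B n δ)).comp (h.n k))

lemma measurable_crossUCBMin (h : MeasurableState mΩ σ) (B : ℕ → ℝ → ℝ) (δ : ℝ) (ℓ : Fin K) :
    Measurable fun ω => (σ ω).crossUCBMin B δ ℓ :=
  Measurable.iInf fun k => h.measurable_crossUCB B δ ℓ k

lemma measurable_lcb (h : MeasurableState mΩ σ) (B : ℕ → ℝ → ℝ) (δ : ℝ) (k : Fin K) :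
    Measurable fun ω => (σ ω).lcb B δ k :=
  Measurable.ite (h.measurableSet_unsampled k) measurable_const <| measurable_coe_real_ereal.comp <|
    (h.measurable_pseudoAvg k k).sub
      ((measurable_from_nat (f := fun n => B n δ)).comp (h.n k))

lemma observe (h : MeasurableState mΩ σ) {s : Fin K → Fin K → ℝ → ℝ} (hs : ∀ ℓ k, Measurable (s ℓ k))
    {a : Ω → Fin K} (ha : Measurable a) {x : Ω → Fin K → ℝ} (hx : Measurable x) :
    MeasurableState mΩ fun ω => (σ ω).observe s (a ω) (x ω (a ω)) where
  active := h.active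
  n k := Measurable.ite (measurableSet_eq_fun measurable_const ha)
    (measurable_from_nat.comp (h.n k) : Measurable fun ω => (σ ω).n k + 1) (h.n k)
  S ℓ k := by
    have : (fun ω => ((σ ω).observe s (a ω) (x ω (a ω))).S ℓ k) = fun ω =>
        if k = a ω then (σ ω).S ℓ k + s ℓ k (x ω k) else (σ ω).S ℓ k := by
      funext ω
      by_cases hk : k = a ω
      · simp [State.observe, ← hk]
      · simp [State.observe, hk]
    rw [this]
    exact Measurable.ite (measurableSet_eq_fun measurable_const ha)
      ((h.S ℓ k).add ((hs ℓ k).comp ((measurable_pi_apply k).comp hx))) (h.S ℓ k)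

lemma eliminate (h : MeasurableState mΩ σ) (B : ℕ → ℝ → ℝ) (δ : ℝ) :
    MeasurableState mΩ fun ω => (σ ω).eliminate B δ where
  active k := by
    have hsup : ∀ ω, (σ ω).active.sup ((σ ω).lcb B (δ / (2 * K))) =
        ⨆ j, if j ∈ (σ ω).active then (σ ω).lcb B (δ / (2 * K)) j else ⊥ := fun ω => by
      rw [Finset.sup_eq_iSup]
      refine iSup_congr fun j => ?_
      by_cases hj : j ∈ (σ ω).active <;> simp [hj]
    have : {ω | k ∈ ((σ ω).eliminate B δ).active} = {ω | k ∈ (σ ω).active} ∩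
        {ω | (⨆ j, if j ∈ (σ ω).active then (σ ω).lcb B (δ / (2 * K)) j else ⊥) ≤
          (σ ω).crossUCBMin B (δ / (2 * K)) k} := by
      ext ω
      simp [State.eliminate, ← hsup]
    rw [this]
    exact (h.active k).inter <| measurableSet_le
      (Measurable.iSup fun j => Measurable.ite (h.active j) (h.measurable_lcb B _ j)
        measurable_const) (h.measurable_crossUCBMin B _ k)
  n := h.n
  S := h.S

lemma ite {σ' : Ω → State K} (h : MeasurableState mΩ σ) (h' : MeasurableState mΩ σ') {p : Ω → Prop}
    [DecidablePred p] (hp : MeasurableSet {ω | p ω}) :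
    MeasurableState mΩ fun ω => if p ω then σ ω else σ' ω where
  active k := by
    have : {ω | k ∈ (if p ω then σ ω else σ' ω).active} =
        Set.ite {ω | p ω} {ω | k ∈ (σ ω).active} {ω | k ∈ (σ' ω).active} := by
      ext ω
      by_cases hω : p ω <;> simp [Set.ite, hω]
    rw [this]
    exact hp.ite (h.active k) (h'.active k)
  n k := by
    simp only [apply_ite (fun τ : State K => τ.n k)]
    exact Measurable.ite hp (h.n k) (h'.n k)
  S ℓ k := by
    simp only [apply_ite (fun τ : State K => τ.S ℓ k)]
    exact Measurable.ite hp (h.S ℓ k) (h'.S ℓ k)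

end MeasurableState

end StateMeasurability

section Run

variable {ν : Measure (Fin K → ℝ)} {s : Fin K → Fin K → ℝ → ℝ} {B : ℕ → ℝ → ℝ} {δ : ℝ}
  {Ω : Type*} [mΩ : MeasurableSpace Ω] {P : Measure Ω} {ℱ : Filtration ℕ mΩ}
  {m : ℕ → Ω → Fin K × Fin K} {X Y : ℕ → Ω → Fin K → ℝ}

lemma IsCLUCBRun.measurableState (hrun : IsCLUCBRun ν s B δ P ℱ m X Y)
    (hs : ∀ ℓ k, Measurable (s ℓ k)) (t : ℕ) :
    MeasurableState (ℱ t) (randState s B δ m X Y t) := by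
  classical
  induction t with
  | zero =>
    exact ⟨fun k => MeasurableSet.const _, fun k => measurable_const, fun ℓ k => measurable_const⟩
  | succ t ih =>
    have ih' := ih.mono (ℱ.mono (Nat.le_succ t))
    have hm := (hrun.measurable_arms t).mono (ℱ.mono (Nat.le_succ t)) le_rfl
    have h1 := ih'.observe hs (measurable_fst.comp hm) (hrun.measurable_X t)
    have h2 := h1.observe hs (measurable_snd.comp hm) (hrun.measurable_Y t)
    exact (h2.eliminate B δ).ite ih' ih'.measurableSet_running

lemma State.IsChoice.ne {σ : State K} {t : ℕ} {p : Fin K × Fin K} (h : σ.IsChoice B δ t p) :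
    p.2 ≠ p.1 := Finset.ne_of_mem_erase h.2.1

lemma State.step_n_S_of_mem {σ : State K} {p : Fin K × Fin K} (hσ : σ.Running) (hp : p.2 ≠ p.1)
    (x y : Fin K → ℝ) (ℓ : Fin K) :
    ((σ.step s B δ p x y).n p.1 = σ.n p.1 + 1 ∧
      (σ.step s B δ p x y).S ℓ p.1 = σ.S ℓ p.1 + s ℓ p.1 (x p.1)) ∧
    ((σ.step s B δ p x y).n p.2 = σ.n p.2 + 1 ∧
      (σ.step s B δ p x y).S ℓ p.2 = σ.S ℓ p.2 + s ℓ p.2 (y p.2)) := by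
  simp [State.step, hσ, State.eliminate, State.observe, hp, hp.symm]

lemma State.step_n_S_of_not_mem {σ : State K} {p : Fin K × Fin K} {k : Fin K}
    (h : σ.Running → k ≠ p.1 ∧ k ≠ p.2) (x y : Fin K → ℝ) (ℓ : Fin K) :
    (σ.step s B δ p x y).n k = σ.n k ∧ (σ.step s B δ p x y).S ℓ k = σ.S ℓ k := by
  by_cases hσ : σ.Running
  · simp [State.step, hσ, State.eliminate, State.observe, h hσ]
  · simp [State.step, hσ]

/-- Samples of an arm that is chosen by looking at the past behave like i.i.d. samples. -/
lemma IsCLUCBRun.measure_exists_sum_mem_le [IsProbabilityMeasure P] [IsProbabilityMeasure ν]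
    (hrun : IsCLUCBRun ν s B δ P ℱ m X Y) (hs : ∀ ℓ k, Measurable (s ℓ k)) (ℓ k : Fin K)
    [IsProbabilityMeasure (ν.map fun x => s ℓ k (x k))]
    (A : ℕ → Set ℝ) (hA : ∀ n, MeasurableSet (A n)) :
    P {ω | ∃ t, (randState s B δ m X Y t ω).S ℓ k ∈ A ((randState s B δ m X Y t ω).n k)} ≤
      Measure.infinitePi (fun _ : ℕ => ν.map fun x => s ℓ k (x k))
        {x | ∃ n : ℕ, ∑ i ∈ Finset.range n, x i ∈ A n} := by
  set σ := randState s B δ m X Y with hσ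
  have hmeas := hrun.measurableState hs
  have hf : Measurable fun x : Fin K → ℝ => s ℓ k (x k) := (hs ℓ k).comp (measurable_pi_apply k)
  refine measure_exists_hit_le P ℱ (fun t ω => (σ t ω).n k) (fun t ω => (σ t ω).S ℓ k) _
    (fun t => (hmeas t).n k) (fun t => (hmeas t).S ℓ k) (fun _ => rfl) (fun _ => rfl) ?_ A hA
  intro t h hh hsup F hF
  -- a sample drawn on an event `G` of the past
  have piece : ∀ (Z : Ω → Fin K → ℝ), Measurable Z → P.map Z = ν →
      Indep (MeasurableSpace.comap Z inferInstance) (ℱ t) P → ∀ G, MeasurableSet[ℱ t] G →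
      (∀ ω ∈ G, (σ (t + 1) ω).n k = (σ t ω).n k + 1 ∧
        (σ (t + 1) ω).S ℓ k = (σ t ω).S ℓ k + s ℓ k (Z ω k)) →
      ∫⁻ ω in G, h ((σ (t + 1) ω).n k) ((σ (t + 1) ω).S ℓ k) ∂P ≤
        ∫⁻ ω in G, h ((σ t ω).n k) ((σ t ω).S ℓ k) ∂P := by
    classical
    intro Z hZ hlaw hind G hG hupd
    have hG' := ℱ.le t _ hG
    let W : Ω → Prop × ℕ × ℝ := fun ω => (ω ∈ G, (σ t ω).n k, (σ t ω).S ℓ k)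
    have hW : Measurable[ℱ t] W :=
      (@measurable_mem _ _ (ℱ t) |>.2 hG).prodMk (((hmeas t).n k).prodMk ((hmeas t).S ℓ k))
    let Φ : Prop × ℕ × ℝ → (Fin K → ℝ) → ENNReal := fun w x =>
      if w.1 then h (w.2.1 + 1) (w.2.2 + s ℓ k (x k)) else 0
    have hΦ : Measurable (Function.uncurry Φ) := by
      refine Measurable.ite ?_ ?_ measurable_const
      · exact (measurable_fst.comp measurable_fst) (MeasurableSet.of_discrete (s := {p : Prop | p}))
      · have h1 : Measurable fun q : ℕ × ℝ => h (q.1 + 1) q.2 :=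
          measurable_from_prod_countable_right fun n => hh (n + 1)
        exact h1.comp (Measurable.prodMk (by fun_prop)
          (Measurable.add (by fun_prop) (hf.comp measurable_snd)))
    calc ∫⁻ ω in G, h ((σ (t + 1) ω).n k) ((σ (t + 1) ω).S ℓ k) ∂P
        = ∫⁻ ω, Φ (W ω) (Z ω) ∂P := by
          rw [← lintegral_indicator hG']
          refine lintegral_congr fun ω => ?_
          by_cases hω : ω ∈ G
          · simp [Φ, W, hω, hupd ω hω]
          · simp [Φ, W, hω]
      _ = ∫⁻ ω, ∫⁻ x, Φ (W ω) x ∂ν ∂P := by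
          rw [lintegral_indep_eq P (ℱ.le t) hZ hind hW hΦ, hlaw]
      _ ≤ ∫⁻ ω in G, h ((σ t ω).n k) ((σ t ω).S ℓ k) ∂P := by
          rw [← lintegral_indicator hG']
          refine lintegral_mono fun ω => ?_
          by_cases hω : ω ∈ G
          · simp only [Φ, W, hω, if_true, Set.indicator_of_mem]
            refine le_trans (le_of_eq ?_) (hsup _ _)
            rw [lintegral_map _ hf]
            exact (hh _).comp (measurable_const.add measurable_id)
          · simp [Φ, W, hω]
  have hR : MeasurableSet[ℱ t] {ω | (σ t ω).Running} :=
    (hmeas t).measurableSet_running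
  have hm1 : MeasurableSet[ℱ t] {ω | (m t ω).1 = k} :=
    (measurable_fst.comp (hrun.measurable_arms t)) (measurableSet_singleton k)
  have hm2 : MeasurableSet[ℱ t] {ω | (m t ω).2 = k} :=
    (measurable_snd.comp (hrun.measurable_arms t)) (measurableSet_singleton k)
  have hsplit : ∀ (g : Ω → ENNReal) (G D : Set Ω), MeasurableSet[ℱ t] D →
      ∫⁻ ω in G, g ω ∂P = ∫⁻ ω in G ∩ D, g ω ∂P + ∫⁻ ω in G \ D, g ω ∂P := fun g G D hD =>
    (lintegral_inter_add_sdiff g G (ℱ.le t _ hD)).symm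
  set D1 := {ω | (σ t ω).Running} ∩ {ω | (m t ω).1 = k}
  set D2 := {ω | (σ t ω).Running} ∩ {ω | (m t ω).2 = k}
  have hD1 : MeasurableSet[ℱ t] D1 := hR.inter hm1
  have hD2 : MeasurableSet[ℱ t] D2 := hR.inter hm2
  rw [hsplit _ F D1 hD1, hsplit _ F D1 hD1, hsplit _ (F \ D1) D2 hD2, hsplit _ (F \ D1) D2 hD2]
  refine add_le_add ?_ (add_le_add ?_ ?_)
  · refine piece (X t) ((hrun.measurable_X t).mono (ℱ.le _) le_rfl) (hrun.law_X t)
      (hrun.indep_X t) _ (hF.inter hD1) ?_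
    rintro ω ⟨-, hr, hk⟩
    obtain rfl : (m t ω).1 = k := hk
    exact (State.step_n_S_of_mem hr (hrun.choice t ω hr).ne _ _ ℓ).1
  · refine piece (Y t) ((hrun.measurable_Y t).mono (ℱ.le _) le_rfl) (hrun.law_Y t)
      (hrun.indep_Y t) _ ((hF.diff hD1).inter hD2) ?_
    rintro ω ⟨-, hr, hk⟩
    obtain rfl : (m t ω).2 = k := hk
    exact (State.step_n_S_of_mem hr (hrun.choice t ω hr).ne _ _ ℓ).2
  · refine le_of_eq (setLIntegral_congr_fun (ℱ.le t _ ((hF.diff hD1).diff hD2)) ?_)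
    rintro ω ⟨⟨-, h1⟩, h2⟩
    have := State.step_n_S_of_not_mem (s := s) (B := B) (δ := δ) (σ := σ t ω) (p := m t ω) (k := k)
      (fun hr => ⟨fun e => h1 ⟨hr, e.symm⟩, fun e => h2 ⟨hr, e.symm⟩⟩) (X t ω) (Y t ω) ℓ
    change h ((σ (t + 1) ω).n k) _ = _
    rw [show (σ (t + 1) ω).n k = (σ t ω).n k from this.1,
      show (σ (t + 1) ω).S ℓ k = (σ t ω).S ℓ k from this.2]

end Run

end CorrBandit

/-! ### Gaps, paths of the algorithm, and probabilities of deviations -/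

namespace CorrBandit

variable {K : ℕ}

section Model

variable {ν : Measure (Fin K → ℝ)} {s : Fin K → Fin K → ℝ → ℝ}
  {ks : Fin K}

lemma IsModel.measurable_pseudoReward (h : IsModel ν s) (ℓ k : Fin K) :
    Measurable fun x : Fin K → ℝ => s ℓ k (x k) :=
  (h.measurable ℓ k).comp (measurable_pi_apply k)

lemma IsModel.ae_pseudoReward_mem (h : IsModel ν s) (ℓ k : Fin K) :
    ∀ᵐ x ∂ν, s ℓ k (x k) ∈ Set.Icc (0 : ℝ) 1 := by
  filter_upwards [h.reward_mem] with x hx using h.pseudo_mem ℓ k _ (hx k)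

lemma IsModel.isProbabilityMeasure_map [IsProbabilityMeasure ν] (h : IsModel ν s) (ℓ k : Fin K) :
    IsProbabilityMeasure (ν.map fun x => s ℓ k (x k)) :=
  Measure.isProbabilityMeasure_map (h.measurable_pseudoReward ℓ k).aemeasurable

lemma IsModel.ae_map_mem (h : IsModel ν s) (ℓ k : Fin K) :
    ∀ᵐ y ∂(ν.map fun x => s ℓ k (x k)), y ∈ Set.Icc (0 : ℝ) 1 :=
  (ae_map_iff (h.measurable_pseudoReward ℓ k).aemeasurable measurableSet_Icc).2
    (h.ae_pseudoReward_mem ℓ k)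

lemma IsModel.integral_map [IsProbabilityMeasure ν] (h : IsModel ν s) (ℓ k : Fin K) :
    ∫ y, y ∂(ν.map fun x => s ℓ k (x k)) = pseudoMean ν s ℓ k :=
  MeasureTheory.integral_map (f := fun y : ℝ => y) (h.measurable_pseudoReward ℓ k).aemeasurable
    measurable_id.aestronglyMeasurable

lemma IsModel.pseudoMean_self (h : IsModel ν s) (k : Fin K) :
    pseudoMean ν s k k = mean ν k := by
  refine integral_congr_ae ?_
  filter_upwards [h.reward_mem] with x hx using h.pseudo_self k _ (hx k)

lemma IsModel.integrable_reward [IsProbabilityMeasure ν] (h : IsModel ν s) (k : Fin K) :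
    Integrable (fun x : Fin K → ℝ => x k) ν :=
  Integrable.of_mem_Icc 0 1 (measurable_pi_apply k).aemeasurable
    (by filter_upwards [h.reward_mem] with x hx using hx k)

lemma IsModel.mean_mem [IsProbabilityMeasure ν] (h : IsModel ν s) (k : Fin K) : mean ν k ∈ Set.Icc (0 : ℝ) 1 := by
  constructor
  · exact integral_nonneg_of_ae (by filter_upwards [h.reward_mem] with x hx using (hx k).1)
  · calc mean ν k ≤ ∫ _, (1 : ℝ) ∂ν := integral_mono_ae (h.integrable_reward k)
          (integrable_const _) (by filter_upwards [h.reward_mem] with x hx using (hx k).2)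
      _ = 1 := by simp

lemma IsModel.mean_le_pseudoMean [IsProbabilityMeasure ν] (h : IsModel ν s) (ℓ k : Fin K) :
    mean ν ℓ ≤ pseudoMean ν s ℓ k := by
  have hm : MeasurableSpace.comap (fun x : Fin K → ℝ => x k) inferInstance ≤
      (inferInstance : MeasurableSpace (Fin K → ℝ)) := (measurable_pi_apply k).comap_le
  rw [mean, ← integral_condExp hm]
  exact integral_mono_ae integrable_condExp
    (Integrable.of_mem_Icc 0 1 (h.measurable_pseudoReward ℓ k).aemeasurable
      (h.ae_pseudoReward_mem ℓ k)) (h.condExp_le ℓ k)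

lemma gap_of_ne {k : Fin K} (hk : k ≠ ks) : gap ν ks k = mean ν ks - mean ν k := by
  simp [gap, hk]

lemma gap_best_le {k : Fin K} (hk : k ≠ ks) : gap ν ks ks ≤ gap ν ks k := by
  rw [gap_of_ne hk, gap, if_pos rfl]
  exact ciInf_le (Set.finite_range _).bddBelow (⟨k, hk⟩ : {j : Fin K // j ≠ ks})

lemma nonempty_ne (hK : 2 ≤ K) (ks : Fin K) : Nonempty {j : Fin K // j ≠ ks} := by
  have : Nontrivial (Fin K) := Fin.nontrivial_iff_two_le.2 hK
  obtain ⟨j, hj⟩ := exists_ne ks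
  exact ⟨⟨j, hj⟩⟩

lemma exists_gap_best_eq (hK : 2 ≤ K) (ν : Measure (Fin K → ℝ)) (ks : Fin K) :
    ∃ j, j ≠ ks ∧ gap ν ks ks = mean ν ks - mean ν j := by
  have := nonempty_ne hK ks
  obtain ⟨j, hj⟩ := exists_eq_ciInf_of_finite
    (f := fun j : {j : Fin K // j ≠ ks} => mean ν ks - mean ν j)
  exact ⟨j, j.2, by rw [gap, if_pos rfl, ← hj]⟩

lemma IsBest.gap_pos (hK : 2 ≤ K) (hb : IsBest ν ks) (k : Fin K) : 0 < gap ν ks k := by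
  by_cases hk : k = ks
  · obtain ⟨j, hj, h⟩ := exists_gap_best_eq hK ν ks
    rw [hk, h, sub_pos]
    exact hb j hj
  · rw [gap_of_ne hk, sub_pos]
    exact hb k hk

lemma IsModel.gap_le_one [IsProbabilityMeasure ν] (h : IsModel ν s) (hK : 2 ≤ K) (ks k : Fin K) : gap ν ks k ≤ 1 := by
  by_cases hk : k = ks
  · obtain ⟨j, hj, hj'⟩ := exists_gap_best_eq hK ν ks
    rw [hk, hj']
    linarith [(h.mean_mem ks).2, (h.mean_mem j).1]
  · rw [gap_of_ne hk]
    linarith [(h.mean_mem ks).2, (h.mean_mem k).1]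

lemma secondMean_le (hK : 2 ≤ K) : secondMean ν ks ≤ mean ν ks - gap ν ks ks := by
  have := nonempty_ne hK ks
  refine ciSup_le fun j => ?_
  have := gap_best_le (ν := ν) j.2
  rw [gap_of_ne j.2] at this
  linarith

lemma pseudoMean_lt_of_not_mem (hK : 2 ≤ K) {k : Fin K} (hk : k ∉ competitive ν s ks) :
    pseudoMean ν s k ks < mean ν ks - gap ν ks ks := by
  rw [competitive, Finset.mem_filter, pseudoGap] at hk
  have := not_le.1 fun h => hk ⟨Finset.mem_univ k, h⟩
  linarith [secondMean_le (ν := ν) (ks := ks) hK]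

lemma IsModel.best_mem_competitive [IsProbabilityMeasure ν] (h : IsModel ν s) (hK : 2 ≤ K) (hb : IsBest ν ks) :
    ks ∈ competitive ν s ks := by
  by_contra hks
  have := pseudoMean_lt_of_not_mem hK hks
  rw [h.pseudoMean_self] at this
  linarith [hb.gap_pos hK ks]

end Model

section Paths

variable {s : Fin K → Fin K → ℝ → ℝ} {B : ℕ → ℝ → ℝ} {δ : ℝ}

/-- A sequence of states `σ` and of pairs of arms `p` that the algorithm can produce. -/
structure IsPath (s : Fin K → Fin K → ℝ → ℝ) (B : ℕ → ℝ → ℝ) (δ : ℝ) (σ : ℕ → State K)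
    (p : ℕ → Fin K × Fin K) : Prop where
  init : σ 0 = State.init K
  step : ∀ t, ∃ x y, σ (t + 1) = (σ t).step s B δ (p t) x y
  choice : ∀ t, (σ t).Running → (σ t).IsChoice B δ (t + 1) (p t)

variable {σ : ℕ → State K} {p : ℕ → Fin K × Fin K}

namespace IsPath

lemma n_zero (h : IsPath s B δ σ p) (k : Fin K) : (σ 0).n k = 0 := by
  rw [h.init]; rfl

lemma n_succ_of_mem (h : IsPath s B δ σ p) {t : ℕ} (ht : (σ t).Running) {k : Fin K}
    (hk : k = (p t).1 ∨ k = (p t).2) : (σ (t + 1)).n k = (σ t).n k + 1 := by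
  obtain ⟨x, y, hxy⟩ := h.step t
  have := State.step_n_S_of_mem (s := s) (B := B) (δ := δ) ht (h.choice t ht).ne x y k
  rw [hxy]
  rcases hk with rfl | rfl
  · exact this.1.1
  · exact this.2.1

lemma n_succ_of_not_mem (h : IsPath s B δ σ p) {t : ℕ} {k : Fin K}
    (hk : (σ t).Running → k ≠ (p t).1 ∧ k ≠ (p t).2) : (σ (t + 1)).n k = (σ t).n k := by
  obtain ⟨x, y, hxy⟩ := h.step t
  rw [hxy]
  exact (State.step_n_S_of_not_mem hk x y k).1

lemma n_le_succ (h : IsPath s B δ σ p) (t : ℕ) (k : Fin K) :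
    (σ t).n k ≤ (σ (t + 1)).n k ∧ (σ (t + 1)).n k ≤ (σ t).n k + 1 := by
  by_cases hk : (σ t).Running ∧ (k = (p t).1 ∨ k = (p t).2)
  · rw [h.n_succ_of_mem hk.1 hk.2]; omega
  · rw [h.n_succ_of_not_mem (k := k) (t := t) (by tauto)]; omega

lemma n_mono (h : IsPath s B δ σ p) (k : Fin K) : Monotone fun t => (σ t).n k :=
  monotone_nat_of_le_succ fun t => (h.n_le_succ t k).1

lemma n_le (h : IsPath s B δ σ p) (t : ℕ) (k : Fin K) : (σ t).n k ≤ t := by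
  induction t with
  | zero => rw [h.n_zero]
  | succ t ih => have := (h.n_le_succ t k).2; omega

lemma succ_of_not_running (h : IsPath s B δ σ p) {t : ℕ} (ht : ¬ (σ t).Running) :
    σ (t + 1) = σ t := by
  obtain ⟨x, y, hxy⟩ := h.step t
  rw [hxy, State.step, if_neg ht]

lemma running_of_le (h : IsPath s B δ σ p) {a b : ℕ} (hab : a ≤ b) (hb : (σ b).Running) :
    (σ a).Running := by
  induction b, hab using Nat.le_induction with
  | base => exact hb
  | succ b _ ih =>
    by_contra ha
    by_cases hrb : (σ b).Running
    · exact ha (ih hrb)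
    · exact hrb (by rwa [h.succ_of_not_running hrb] at hb)

/-- Different rounds which sample an arm find it with different numbers of samples. -/
lemma injOn_n (h : IsPath s B δ σ p) (k : Fin K) :
    Set.InjOn (fun t => (σ t).n k) {t | (σ t).Running ∧ (k = (p t).1 ∨ k = (p t).2)} := by
  have hlt : ∀ a ∈ {t | (σ t).Running ∧ (k = (p t).1 ∨ k = (p t).2)}, ∀ b, a < b →
      (σ a).n k < (σ b).n k := fun a ha b hab => by
    have h1 := h.n_succ_of_mem ha.1 ha.2
    have h2 : (σ (a + 1)).n k ≤ (σ b).n k := h.n_mono k hab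
    omega
  intro a ha b hb hab
  rcases lt_trichotomy a b with hl | rfl | hl
  · exact absurd hab (hlt a ha b hl).ne
  · rfl
  · exact absurd hab (hlt b hb a hl).ne'

end IsPath

variable {ν : Measure (Fin K → ℝ)} {Ω : Type*} [mΩ : MeasurableSpace Ω] {P : Measure Ω}
  {ℱ : Filtration ℕ mΩ} {m : ℕ → Ω → Fin K × Fin K} {X Y : ℕ → Ω → Fin K → ℝ}

lemma IsCLUCBRun.isPath (h : IsCLUCBRun ν s B δ P ℱ m X Y) (ω : Ω) :
    IsPath s B δ (fun t => randState s B δ m X Y t ω) fun t => m t ω :=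
  ⟨rfl, fun t => ⟨X t ω, Y t ω, rfl⟩, fun t => h.choice t ω⟩

end Paths

section Deviations

variable {ν : Measure (Fin K → ℝ)} {s : Fin K → Fin K → ℝ → ℝ}
  {B : ℕ → ℝ → ℝ} {δ : ℝ} {Ω : Type*} [mΩ : MeasurableSpace Ω] {P : Measure Ω}
  {ℱ : Filtration ℕ mΩ}
  {m : ℕ → Ω → Fin K × Fin K} {X Y : ℕ → Ω → Fin K → ℝ}

lemma measure_exists_above_le [IsProbabilityMeasure ν] [IsProbabilityMeasure P]
    (hs : IsModel ν s) (hrun : IsCLUCBRun ν s B δ P ℱ m X Y)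
    (hB : IsAnytimeBound B) {ε : ℝ} (hε : 0 < ε) (hε1 : ε < 1) (ℓ k : Fin K) :
    P {ω | ∃ t, 1 ≤ (randState s B δ m X Y t ω).n k ∧ pseudoMean ν s ℓ k +
      B ((randState s B δ m X Y t ω).n k) ε < (randState s B δ m X Y t ω).pseudoAvg ℓ k} ≤
      ENNReal.ofReal (ε / 2) := by
  have := hs.isProbabilityMeasure_map ℓ k
  have h1 := (hB _ (hs.ae_map_mem ℓ k) ε hε hε1).1
  rw [hs.integral_map] at h1
  refine le_trans (hrun.measure_exists_sum_mem_le hs.measurable ℓ k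
    (fun n => {z | 1 ≤ n ∧ pseudoMean ν s ℓ k + B n ε < z / n}) fun n => ?_) h1
  exact (MeasurableSet.const _).inter (measurableSet_lt measurable_const (measurable_id.div_const _))

lemma measure_exists_below_le [IsProbabilityMeasure ν] [IsProbabilityMeasure P]
    (hs : IsModel ν s) (hrun : IsCLUCBRun ν s B δ P ℱ m X Y)
    (hB : IsAnytimeBound B) {ε : ℝ} (hε : 0 < ε) (hε1 : ε < 1) (ℓ k : Fin K) :
    P {ω | ∃ t, 1 ≤ (randState s B δ m X Y t ω).n k ∧
      (randState s B δ m X Y t ω).pseudoAvg ℓ k < pseudoMean ν s ℓ k -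
        B ((randState s B δ m X Y t ω).n k) ε} ≤ ENNReal.ofReal (ε / 2) := by
  have := hs.isProbabilityMeasure_map ℓ k
  have h1 := (hB _ (hs.ae_map_mem ℓ k) ε hε hε1).2
  rw [hs.integral_map] at h1
  refine le_trans (hrun.measure_exists_sum_mem_le hs.measurable ℓ k
    (fun n => {z | 1 ≤ n ∧ z / n < pseudoMean ν s ℓ k - B n ε}) fun n => ?_) h1
  exact (MeasurableSet.const _).inter (measurableSet_lt (measurable_id.div_const _) measurable_const)

/-- At the sample size `n`, whenever it occurs, the average obeys Hoeffding's inequality. -/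
lemma measure_exists_eq_above_le [IsProbabilityMeasure ν] [IsProbabilityMeasure P]
    (hs : IsModel ν s) (hrun : IsCLUCBRun ν s B δ P ℱ m X Y)
    {n : ℕ} (hn : 1 ≤ n) {ε : ℝ} (hε : 0 ≤ ε) (ℓ k : Fin K) :
    P {ω | ∃ t, (randState s B δ m X Y t ω).n k = n ∧
      pseudoMean ν s ℓ k + ε ≤ (randState s B δ m X Y t ω).pseudoAvg ℓ k} ≤
      ENNReal.ofReal (Real.exp (-(2 * n * ε ^ 2))) := by
  have := hs.isProbabilityMeasure_map ℓ k
  have h1 := infinitePi_avg_ge_le _ (hs.ae_map_mem ℓ k) hn hε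
  rw [hs.integral_map] at h1
  refine le_trans (hrun.measure_exists_sum_mem_le hs.measurable ℓ k
    (fun j => {z | j = n ∧ pseudoMean ν s ℓ k + ε ≤ z / j}) fun j => ?_)
    (le_trans (measure_mono ?_) h1)
  · exact (MeasurableSet.const _).inter (measurableSet_le measurable_const (measurable_id.div_const _))
  · rintro x ⟨j, rfl, hj⟩
    exact hj

lemma measure_exists_eq_below_le [IsProbabilityMeasure ν] [IsProbabilityMeasure P]
    (hs : IsModel ν s) (hrun : IsCLUCBRun ν s B δ P ℱ m X Y)
    {n : ℕ} (hn : 1 ≤ n) {ε : ℝ} (hε : 0 ≤ ε) (ℓ k : Fin K) :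
    P {ω | ∃ t, (randState s B δ m X Y t ω).n k = n ∧
      (randState s B δ m X Y t ω).pseudoAvg ℓ k ≤ pseudoMean ν s ℓ k - ε} ≤
      ENNReal.ofReal (Real.exp (-(2 * n * ε ^ 2))) := by
  have := hs.isProbabilityMeasure_map ℓ k
  have h1 := infinitePi_avg_le_le _ (hs.ae_map_mem ℓ k) hn hε
  rw [hs.integral_map] at h1
  refine le_trans (hrun.measure_exists_sum_mem_le hs.measurable ℓ k
    (fun j => {z | j = n ∧ z / j ≤ pseudoMean ν s ℓ k - ε}) fun j => ?_)
    (le_trans (measure_mono ?_) h1)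
  · exact (MeasurableSet.const _).inter (measurableSet_le (measurable_id.div_const _) measurable_const)
  · rintro x ⟨j, rfl, hj⟩
    exact hj

/-- The radius of the PseudoUCB index at round `t` after `n` samples. -/
noncomputable def radius (t n : ℕ) : ℝ := √(2 * Real.log t / n)

lemma exp_radius (t : ℕ) {n : ℕ} (hn : 1 ≤ n) :
    Real.exp (-(2 * n * radius (t + 1) n ^ 2)) = 1 / ((t : ℝ) + 1) ^ 4 := by
  have hn' : (n : ℝ) ≠ 0 := by positivity
  have ht : (0 : ℝ) < (t : ℝ) + 1 := by positivity
  have hlog : 0 ≤ Real.log ((t : ℝ) + 1) := Real.log_nonneg (by linarith [t.cast_nonneg (α := ℝ)])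
  rw [radius, Real.sq_sqrt (by push_cast; positivity)]
  have : -(2 * (n : ℝ) * (2 * Real.log ((t + 1 : ℕ) : ℝ) / n)) =
      -(Real.log (((t : ℝ) + 1) ^ 4)) := by
    rw [Real.log_pow]; push_cast; field_simp; ring
  rw [this, Real.exp_neg, Real.exp_log (by positivity), one_div]

/-- One of the averages on which the analysis of round `t` relies is off by more than the radius
of the PseudoUCB index. -/
def Deviates (ν : Measure (Fin K → ℝ)) (s : Fin K → Fin K → ℝ → ℝ) (ks : Fin K) (t : ℕ)
    (σ : State K) : Prop :=
  ∃ k, (1 ≤ σ.n k ∧ σ.pseudoAvg ks k < pseudoMean ν s ks k - radius t (σ.n k)) ∨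
    (1 ≤ σ.n k ∧ pseudoMean ν s k k + radius t (σ.n k) < σ.pseudoAvg k k) ∨
    (1 ≤ σ.n ks ∧ pseudoMean ν s k ks + radius t (σ.n ks) < σ.pseudoAvg k ks)

lemma measure_deviates_le [IsProbabilityMeasure ν] [IsProbabilityMeasure P]
    (hs : IsModel ν s) (hrun : IsCLUCBRun ν s B δ P ℱ m X Y) (ks : Fin K)
    (t : ℕ) :
    P {ω | Deviates ν s ks (t + 1) (randState s B δ m X Y t ω)} ≤
      ENNReal.ofReal (3 * K * (t / ((t : ℝ) + 1) ^ 4)) := by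
  set σ := randState s B δ m X Y with hσ
  have hsum : ∀ (E : Set Ω) (F : ℕ → Set Ω), (∀ ω ∈ E, ∃ n ∈ Finset.Icc 1 t, ω ∈ F n) →
      (∀ n, 1 ≤ n → P (F n) ≤ ENNReal.ofReal (Real.exp (-(2 * n * radius (t + 1) n ^ 2)))) →
      P E ≤ ENNReal.ofReal (t / ((t : ℝ) + 1) ^ 4) := fun E F hEF hF => by
    calc P E ≤ P (⋃ n ∈ Finset.Icc 1 t, F n) := measure_mono fun ω hω => by
          obtain ⟨n, hn, h⟩ := hEF ω hω
          exact Set.mem_biUnion hn h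
      _ ≤ ∑ n ∈ Finset.Icc 1 t, P (F n) := measure_biUnion_finset_le _ _
      _ ≤ ∑ n ∈ Finset.Icc 1 t, ENNReal.ofReal (1 / ((t : ℝ) + 1) ^ 4) :=
          Finset.sum_le_sum fun n hn => by
            have hn1 := (Finset.mem_Icc.1 hn).1
            exact (hF n hn1).trans_eq (by rw [exp_radius t hn1])
      _ = ENNReal.ofReal (t / ((t : ℝ) + 1) ^ 4) := by
          rw [Finset.sum_const, Nat.card_Icc, Nat.add_sub_cancel, nsmul_eq_mul,
            ← ENNReal.ofReal_natCast, ← ENNReal.ofReal_mul t.cast_nonneg]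
          congr 1
          ring
  have hr : ∀ n, 0 ≤ radius (t + 1) n := fun n => Real.sqrt_nonneg _
  have hup : ∀ ℓ k, P {ω | 1 ≤ (σ t ω).n k ∧ pseudoMean ν s ℓ k + radius (t + 1) ((σ t ω).n k) <
      (σ t ω).pseudoAvg ℓ k} ≤ ENNReal.ofReal (t / ((t : ℝ) + 1) ^ 4) := fun ℓ k =>
    hsum _ _ (fun ω hω => ⟨(σ t ω).n k, Finset.mem_Icc.2 ⟨hω.1, (hrun.isPath ω).n_le t k⟩, by
      exact ⟨t, rfl, hω.2.le⟩⟩) fun n hn => measure_exists_eq_above_le hs hrun hn (hr n) ℓ k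
  have hlow : ∀ ℓ k, P {ω | 1 ≤ (σ t ω).n k ∧ (σ t ω).pseudoAvg ℓ k <
      pseudoMean ν s ℓ k - radius (t + 1) ((σ t ω).n k)} ≤
        ENNReal.ofReal (t / ((t : ℝ) + 1) ^ 4) := fun ℓ k =>
    hsum _ _ (fun ω hω => ⟨(σ t ω).n k, Finset.mem_Icc.2 ⟨hω.1, (hrun.isPath ω).n_le t k⟩, by
      exact ⟨t, rfl, hω.2.le⟩⟩) fun n hn => measure_exists_eq_below_le hs hrun hn (hr n) ℓ k
  calc P {ω | Deviates ν s ks (t + 1) (σ t ω)}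
      = P (⋃ k, ({ω | 1 ≤ (σ t ω).n k ∧ (σ t ω).pseudoAvg ks k <
            pseudoMean ν s ks k - radius (t + 1) ((σ t ω).n k)} ∪
          ({ω | 1 ≤ (σ t ω).n k ∧ pseudoMean ν s k k + radius (t + 1) ((σ t ω).n k) <
            (σ t ω).pseudoAvg k k} ∪
          {ω | 1 ≤ (σ t ω).n ks ∧ pseudoMean ν s k ks + radius (t + 1) ((σ t ω).n ks) <
            (σ t ω).pseudoAvg k ks}))) := by
        congr 1
        ext ω
        simp [Deviates]
    _ ≤ ∑ k : Fin K, ENNReal.ofReal (3 * (t / ((t : ℝ) + 1) ^ 4)) := by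
        refine (measure_iUnion_fintype_le _ _).trans (Finset.sum_le_sum fun k _ => ?_)
        have h3 : ENNReal.ofReal (3 * (t / ((t : ℝ) + 1) ^ 4)) =
            ENNReal.ofReal (t / ((t : ℝ) + 1) ^ 4) + (ENNReal.ofReal (t / ((t : ℝ) + 1) ^ 4) +
              ENNReal.ofReal (t / ((t : ℝ) + 1) ^ 4)) := by
          rw [← ENNReal.ofReal_add (by positivity) (by positivity),
            ← ENNReal.ofReal_add (by positivity) (by positivity)]
          congr 1
          ring
        rw [h3]
        exact (measure_union_le _ _).trans (add_le_add (hlow ks k)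
          ((measure_union_le _ _).trans (add_le_add (hup k k) (hup k ks))))
    _ = ENNReal.ofReal (3 * K * (t / ((t : ℝ) + 1) ^ 4)) := by
        rw [Finset.sum_const, Finset.card_univ, Fintype.card_fin, nsmul_eq_mul,
          ← ENNReal.ofReal_natCast, ← ENNReal.ofReal_mul K.cast_nonneg]
        congr 1
        ring

/-- In expectation, deviations occur at no more than `3 K` rounds. -/
lemma sum_measure_deviates_le [IsProbabilityMeasure ν] [IsProbabilityMeasure P]
    (hs : IsModel ν s) (hrun : IsCLUCBRun ν s B δ P ℱ m X Y)
    (ks : Fin K) (M : ℕ) :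
    ∑ t ∈ Finset.range M, P {ω | Deviates ν s ks (t + 1) (randState s B δ m X Y t ω)} ≤
      ENNReal.ofReal (3 * K) := by
  have htel : ∀ M : ℕ, ∑ t ∈ Finset.range M, (t / ((t : ℝ) + 1) ^ 4) ≤ 1 - 1 / ((M : ℝ) + 1) := by
    intro M
    induction M with
    | zero => simp
    | succ M ih =>
      rw [Finset.sum_range_succ]
      have hM : (0 : ℝ) ≤ M := M.cast_nonneg
      have : (M : ℝ) / ((M : ℝ) + 1) ^ 4 ≤ 1 / ((M : ℝ) + 1) - 1 / ((M : ℝ) + 1 + 1) := by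
        rw [div_sub_div _ _ (by positivity) (by positivity),
          div_le_div_iff₀ (by positivity) (by positivity)]
        nlinarith [mul_nonneg hM hM, mul_nonneg hM (mul_nonneg hM hM),
          mul_nonneg (mul_nonneg hM hM) (mul_nonneg hM hM)]
      push_cast
      linarith
  calc _ ≤ ∑ t ∈ Finset.range M, ENNReal.ofReal (3 * K * (t / ((t : ℝ) + 1) ^ 4)) :=
        Finset.sum_le_sum fun t _ => measure_deviates_le hs hrun ks t
    _ = ENNReal.ofReal (3 * K * ∑ t ∈ Finset.range M, (t / ((t : ℝ) + 1) ^ 4)) := by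
        rw [Finset.mul_sum, ENNReal.ofReal_sum_of_nonneg fun t _ => by positivity]
    _ ≤ ENNReal.ofReal (3 * K) := by
        refine ENNReal.ofReal_le_ofReal ?_
        have h0 : 0 ≤ 1 / ((M : ℝ) + 1) := by positivity
        have h1 : ∑ t ∈ Finset.range M, (t / ((t : ℝ) + 1) ^ 4) ≤ 1 := by linarith [htel M]
        exact mul_le_of_le_one_right (by positivity) h1

/-- In expectation, an average exceeds its mean by `ε` at no more than `1 / (2 ε²)` sample sizes. -/
lemma sum_measure_exists_eq_above_le [IsProbabilityMeasure ν] [IsProbabilityMeasure P]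
    (hs : IsModel ν s) (hrun : IsCLUCBRun ν s B δ P ℱ m X Y)
    {ε : ℝ} (hε : 0 < ε) (ℓ k : Fin K) (M : ℕ) :
    ∑ n ∈ Finset.range M, P {ω | ∃ t, (randState s B δ m X Y t ω).n k = n + 1 ∧
      pseudoMean ν s ℓ k + ε ≤ (randState s B δ m X Y t ω).pseudoAvg ℓ k} ≤
      ENNReal.ofReal (1 / (2 * ε ^ 2)) := by
  set r := Real.exp (-(2 * ε ^ 2)) with hr
  have hpow : ∀ n : ℕ, Real.exp (-(2 * ((n + 1 : ℕ) : ℝ) * ε ^ 2)) = r * r ^ n := fun n => by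
    rw [hr, ← Real.exp_nat_mul, ← Real.exp_add]
    congr 1
    push_cast
    ring
  have hr0 : 0 < r := Real.exp_pos _
  calc _ ≤ ∑ n ∈ Finset.range M, ENNReal.ofReal (r * r ^ n) :=
        Finset.sum_le_sum fun n _ => by
          rw [← hpow n]
          exact measure_exists_eq_above_le hs hrun (by omega) hε.le ℓ k
    _ = ENNReal.ofReal (r * ∑ n ∈ Finset.range M, r ^ n) := by
        rw [Finset.mul_sum, ENNReal.ofReal_sum_of_nonneg fun t _ => by positivity]
    _ ≤ ENNReal.ofReal (1 / (2 * ε ^ 2)) := by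
        refine ENNReal.ofReal_le_ofReal ?_
        have hgeo : (1 - r) * ∑ n ∈ Finset.range M, r ^ n = 1 - r ^ M := mul_neg_geom_sum r M
        -- `e^a ≥ 1 + a` with `a = 2 ε²`, multiplied by `r = e^{-a}`
        have hexp : r * (1 + 2 * ε ^ 2) ≤ 1 := by
          calc r * (1 + 2 * ε ^ 2) ≤ r * Real.exp (2 * ε ^ 2) := by
                gcongr
                linarith [Real.add_one_le_exp (2 * ε ^ 2)]
            _ = 1 := by rw [hr, ← Real.exp_add]; simp
        have hS : 0 ≤ ∑ n ∈ Finset.range M, r ^ n := Finset.sum_nonneg fun n _ => by positivity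
        rw [le_div_iff₀ (by positivity)]
        have hpos : 0 ≤ r ^ M := by positivity
        nlinarith [mul_le_mul_of_nonneg_right hexp hS]

end Deviations

section GoodEvent

variable {ν : Measure (Fin K → ℝ)} {s : Fin K → Fin K → ℝ → ℝ}
  {B : ℕ → ℝ → ℝ} {δ : ℝ} {ks : Fin K}

/-- The three confidence statements about the state `σ` hold, in terms of real numbers. -/
structure State.Confident (σ : State K) (ν : Measure (Fin K → ℝ)) (s : Fin K → Fin K → ℝ → ℝ)
    (B : ℕ → ℝ → ℝ) (ε : ℝ) (ks : Fin K) : Prop where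
  lower : ∀ k, 1 ≤ σ.n k → σ.pseudoAvg k k ≤ mean ν k + B (σ.n k) ε
  upper : ∀ k, 1 ≤ σ.n k → mean ν k ≤ σ.pseudoAvg k k + B (σ.n k) ε
  best : ∀ k, 1 ≤ σ.n k → pseudoMean ν s ks k ≤ σ.pseudoAvg ks k + B (σ.n k) ε

lemma State.coe_le_crossUCB_iff {σ : State K} {ε a : ℝ} {ℓ k : Fin K} :
    (a : EReal) ≤ σ.crossUCB B ε ℓ k ↔ (1 ≤ σ.n k → a ≤ σ.pseudoAvg ℓ k + B (σ.n k) ε) := by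
  rw [State.crossUCB]
  split_ifs with h
  · simp [h]
  · rw [EReal.coe_le_coe_iff]
    exact ⟨fun h' _ => h', fun h' => h' (Nat.one_le_iff_ne_zero.2 h)⟩

lemma State.lcb_le_coe_iff {σ : State K} {ε a : ℝ} {k : Fin K} :
    σ.lcb B ε k ≤ (a : EReal) ↔ (1 ≤ σ.n k → σ.pseudoAvg k k - B (σ.n k) ε ≤ a) := by
  rw [State.lcb]
  split_ifs with h
  · simp [h]
  · rw [EReal.coe_le_coe_iff]
    exact ⟨fun h' _ => h', fun h' => h' (Nat.one_le_iff_ne_zero.2 h)⟩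

lemma confident_of_mem_goodEvent {Ω : Type*} {m : ℕ → Ω → Fin K × Fin K}
    {X Y : ℕ → Ω → Fin K → ℝ} {ω : Ω} (hω : ω ∈ goodEvent ν s B δ ks m X Y) (t : ℕ) :
    (randState s B δ m X Y t ω).Confident ν s B (δ / (2 * K)) ks := by
  cases t with
  | zero => exact ⟨fun k h => absurd h (by simp [randState, stateAfter, State.init]),
      fun k h => absurd h (by simp [randState, stateAfter, State.init]),
      fun k h => absurd h (by simp [randState, stateAfter, State.init])⟩
  | succ t =>
    have ht : 1 ≤ t + 1 := by omega
    refine ⟨fun k hk => ?_, fun k hk => ?_, fun k hk => ?_⟩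
    · linarith [State.lcb_le_coe_iff.1 (hω.1.1 _ ht k).1 hk]
    · exact State.coe_le_crossUCB_iff.1 (hω.1.1 _ ht k).2 hk
    · exact State.coe_le_crossUCB_iff.1 (hω.1.2 _ ht k) hk

variable {Ω : Type*} [mΩ : MeasurableSpace Ω] {P : Measure Ω} {ℱ : Filtration ℕ mΩ}
  {m : ℕ → Ω → Fin K × Fin K} {X Y : ℕ → Ω → Fin K → ℝ}

lemma measurableSet_goodEvent (hrun : IsCLUCBRun ν s B δ P ℱ m X Y)
    (hs : ∀ ℓ k, Measurable (s ℓ k)) : MeasurableSet (goodEvent ν s B δ ks m X Y) := by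
  have hσ : ∀ t, MeasurableState mΩ (randState s B δ m X Y t) := fun t =>
    (hrun.measurableState hs t).mono (ℱ.le t)
  refine (MeasurableSet.inter ?_ ?_).inter ?_
  · simp only [event1, Set.ofPred_forall]
    exact MeasurableSet.iInter fun t => MeasurableSet.iInter fun _ => MeasurableSet.iInter fun k =>
      (measurableSet_le ((hσ t).measurable_lcb B _ k) measurable_const).inter
        (measurableSet_le measurable_const ((hσ t).measurable_crossUCB B _ k k))
  · simp only [event2, Set.ofPred_forall]
    exact MeasurableSet.iInter fun t => MeasurableSet.iInter fun _ => MeasurableSet.iInter fun k =>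
      measurableSet_le measurable_const ((hσ t).measurable_crossUCB B _ ks k)
  · simp only [event3, Set.ofPred_forall]
    exact MeasurableSet.iInter fun t => MeasurableSet.iInter fun _ => MeasurableSet.iInter fun k =>
      measurableSet_le measurable_const ((hσ t).measurable_crossUCB B _ k ks)

/-- A union bound over `4 K` one-sided confidence statements at level `δ / (2 K)`. -/
lemma ofReal_one_sub_le_measure_goodEvent [IsProbabilityMeasure ν] [IsProbabilityMeasure P] (hK : 2 ≤ K)
    (hs : IsModel ν s) (hrun : IsCLUCBRun ν s B δ P ℱ m X Y) (hB : IsAnytimeBound B) (hδ : 0 < δ)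
    (hδ1 : δ < 1) : ENNReal.ofReal (1 - δ) ≤ P (goodEvent ν s B δ ks m X Y) := by
  set σ := randState s B δ m X Y with hσ
  have hK' : (2 : ℝ) ≤ K := by exact_mod_cast hK
  set ε := δ / (2 * K) with hε
  have hε0 : 0 < ε := by positivity
  have hε1 : ε < 1 := by rw [hε, div_lt_one (by positivity)]; linarith
  let up : Fin K → Fin K → Set Ω := fun ℓ k =>
    {ω | ∃ t, 1 ≤ (σ t ω).n k ∧ pseudoMean ν s ℓ k + B ((σ t ω).n k) ε < (σ t ω).pseudoAvg ℓ k}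
  let low : Fin K → Fin K → Set Ω := fun ℓ k =>
    {ω | ∃ t, 1 ≤ (σ t ω).n k ∧ (σ t ω).pseudoAvg ℓ k < pseudoMean ν s ℓ k - B ((σ t ω).n k) ε}
  have hup : ∀ ℓ k, P (up ℓ k) ≤ ENNReal.ofReal (ε / 2) := fun ℓ k =>
    measure_exists_above_le hs hrun hB hε0 hε1 ℓ k
  have hlow : ∀ ℓ k, P (low ℓ k) ≤ ENNReal.ofReal (ε / 2) := fun ℓ k =>
    measure_exists_below_le hs hrun hB hε0 hε1 ℓ k
  have hsub : (goodEvent ν s B δ ks m X Y)ᶜ ⊆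
      ⋃ k, ((up k k ∪ low k k) ∪ (low ks k ∪ low k ks)) := by
    intro ω hω
    by_contra hcon
    simp only [Set.mem_iUnion, Set.mem_union, not_exists, not_or] at hcon
    have hlow' : ∀ ℓ k, ω ∉ low ℓ k → ∀ t, 1 ≤ t → (pseudoMean ν s ℓ k : EReal) ≤
        (σ t ω).crossUCB B ε ℓ k := fun ℓ k h t _ => by
      refine State.coe_le_crossUCB_iff.2 fun hn => ?_
      by_contra h'
      exact h ⟨t, hn, by linarith⟩
    refine hω ⟨⟨fun t ht k => ⟨?_, ?_⟩, fun t ht k => hlow' ks k (hcon k).2.1 t ht⟩,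
      fun t ht k => hlow' k ks (hcon k).2.2 t ht⟩
    · refine State.lcb_le_coe_iff.2 fun hn => ?_
      by_contra h'
      exact (hcon k).1.1 ⟨t, hn, by rw [hs.pseudoMean_self]; linarith⟩
    · rw [← hs.pseudoMean_self]
      exact hlow' k k (hcon k).1.2 t ht
  have hcompl : P (goodEvent ν s B δ ks m X Y)ᶜ ≤ ENNReal.ofReal δ := by
    calc _ ≤ ∑ k : Fin K, P ((up k k ∪ low k k) ∪ (low ks k ∪ low k ks)) :=
          (measure_mono hsub).trans (measure_iUnion_fintype_le _ _)
      _ ≤ ∑ k : Fin K, ENNReal.ofReal (2 * ε) := Finset.sum_le_sum fun k _ => by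
          have h4 : ENNReal.ofReal (2 * ε) = (ENNReal.ofReal (ε / 2) + ENNReal.ofReal (ε / 2)) +
              (ENNReal.ofReal (ε / 2) + ENNReal.ofReal (ε / 2)) := by
            rw [← ENNReal.ofReal_add (by positivity) (by positivity),
              ← ENNReal.ofReal_add (by positivity) (by positivity)]
            congr 1
            ring
          rw [h4]
          exact (measure_union_le _ _).trans (add_le_add
            ((measure_union_le _ _).trans (add_le_add (hup k k) (hlow k k)))
            ((measure_union_le _ _).trans (add_le_add (hlow ks k) (hlow k ks))))
      _ = ENNReal.ofReal δ := by
          rw [Finset.sum_const, Finset.card_univ, Fintype.card_fin, nsmul_eq_mul,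
            ← ENNReal.ofReal_natCast, ← ENNReal.ofReal_mul K.cast_nonneg, hε]
          congr 1
          field_simp
  rw [ENNReal.ofReal_sub _ hδ.le, ENNReal.ofReal_one, tsub_le_iff_right]
  calc (1 : ENNReal) = P Set.univ := measure_univ.symm
    _ ≤ P (goodEvent ν s B δ ks m X Y) + P (goodEvent ν s B δ ks m X Y)ᶜ := by
        rw [← Set.union_compl_self (goodEvent ν s B δ ks m X Y)]
        exact measure_union_le _ _
    _ ≤ _ := add_le_add le_rfl hcompl

end GoodEvent

end CorrBandit

/-! ### The rounds on the good event -/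

namespace CorrBandit

variable {K : ℕ} {ν : Measure (Fin K → ℝ)} {s : Fin K → Fin K → ℝ → ℝ} {B : ℕ → ℝ → ℝ} {δ : ℝ}
  {ks : Fin K}

section Rounds

lemma State.coe_le_pseudoUCB_iff {σ : State K} {a : ℝ} {t : ℕ} {ℓ k : Fin K} :
    (a : EReal) ≤ σ.pseudoUCB t ℓ k ↔ (1 ≤ σ.n k → a ≤ σ.pseudoAvg ℓ k + radius t (σ.n k)) := by
  rw [State.pseudoUCB, radius]
  split_ifs with h
  · simp [h]
  · rw [EReal.coe_le_coe_iff]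
    exact ⟨fun h' _ => h', fun h' => h' (Nat.one_le_iff_ne_zero.2 h)⟩

/-- When no average deviates, the PseudoUCB index of the best arm is optimistic. -/
lemma mean_le_pseudoUCBMin [IsProbabilityMeasure ν] (hs : IsModel ν s) {σ : State K} {t : ℕ}
    (hdev : ¬ Deviates ν s ks t σ) : (mean ν ks : EReal) ≤ σ.pseudoUCBMin t ks := by
  refine le_iInf fun j => State.coe_le_pseudoUCB_iff.2 fun hj => ?_
  have : ¬ σ.pseudoAvg ks j < pseudoMean ν s ks j - radius t (σ.n j) := fun h =>
    hdev ⟨j, Or.inl ⟨hj, h⟩⟩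
  linarith [hs.mean_le_pseudoMean ks j]

variable {σ : ℕ → State K} {p : ℕ → Fin K × Fin K}

namespace IsPath

lemma choice_mem_active (h : IsPath s B δ σ p) {t : ℕ} (ht : (σ t).Running) :
    (p t).1 ∈ (σ t).active ∧ (p t).2 ∈ (σ t).active :=
  ⟨(h.choice t ht).1.1, Finset.mem_of_mem_erase (h.choice t ht).2.1⟩

/-- The elimination rule: it compares with indices of the state that it leaves behind. -/
lemma mem_active_succ_iff (h : IsPath s B δ σ p) {t : ℕ} (ht : (σ t).Running) (k : Fin K) :
    k ∈ (σ (t + 1)).active ↔ k ∈ (σ t).active ∧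
      (σ t).active.sup ((σ (t + 1)).lcb B (δ / (2 * K))) ≤
        (σ (t + 1)).crossUCBMin B (δ / (2 * K)) k := by
  classical
  obtain ⟨x, y, hxy⟩ := h.step t
  rw [hxy, State.step, if_pos ht, ← not_lt]
  exact Finset.mem_filter

variable [IsProbabilityMeasure ν]

lemma best_mem_active (h : IsPath s B δ σ p) (hs : IsModel ν s) (hb : IsBest ν ks)
    (hconf : ∀ t, (σ t).Confident ν s B (δ / (2 * K)) ks) (t : ℕ) : ks ∈ (σ t).active := by
  induction t with
  | zero => rw [h.init]; exact Finset.mem_univ ks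
  | succ t ih =>
    by_cases ht : (σ t).Running
    · refine (h.mem_active_succ_iff ht ks).2 ⟨ih, le_trans (b := (mean ν ks : EReal)) ?_ ?_⟩
      · refine Finset.sup_le fun k _ => State.lcb_le_coe_iff.2 fun hk => ?_
        have h1 := (hconf (t + 1)).lower k hk
        have h2 : mean ν k ≤ mean ν ks := by
          by_cases hkk : k = ks
          · rw [hkk]
          · exact (hb k hkk).le
        linarith
      · exact le_iInf fun j => State.coe_le_crossUCB_iff.2 fun hj =>
          (hs.mean_le_pseudoMean ks j).trans ((hconf (t + 1)).best j hj)
    · rwa [h.succ_of_not_running ht]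

lemma lcb_best_le_crossUCBMin (h : IsPath s B δ σ p) (hs : IsModel ν s) (hb : IsBest ν ks)
    (hconf : ∀ t, (σ t).Confident ν s B (δ / (2 * K)) ks) (t : ℕ) {k : Fin K}
    (hk : k ∈ (σ t).active) :
    (σ t).lcb B (δ / (2 * K)) ks ≤ (σ t).crossUCBMin B (δ / (2 * K)) k := by
  induction t with
  | zero => simp [State.lcb, h.n_zero]
  | succ t ih =>
    by_cases ht : (σ t).Running
    · exact (Finset.le_sup (h.best_mem_active hs hb hconf t)).trans
        ((h.mem_active_succ_iff ht k).1 hk).2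
    · rw [h.succ_of_not_running ht] at hk ⊢
      exact ih hk

/-- An active arm has a CrossUCB index above the true mean of the best arm, up to confidence
widths. -/
lemma mean_best_le_of_mem_active (h : IsPath s B δ σ p) (hs : IsModel ν s) (hb : IsBest ν ks)
    (hconf : ∀ t, (σ t).Confident ν s B (δ / (2 * K)) ks) {t : ℕ} {k : Fin K}
    (hk : k ∈ (σ t).active) (hks : 1 ≤ (σ t).n ks) {j : Fin K} (hj : 1 ≤ (σ t).n j) :
    mean ν ks ≤ (σ t).pseudoAvg k j + B ((σ t).n j) (δ / (2 * K)) +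
      2 * B ((σ t).n ks) (δ / (2 * K)) := by
  have h1 : (σ t).lcb B (δ / (2 * K)) ks ≤ (σ t).crossUCB B (δ / (2 * K)) k j :=
    (h.lcb_best_le_crossUCBMin hs hb hconf t hk).trans (iInf_le _ j)
  rw [State.lcb, if_neg (by omega)] at h1
  have h2 := State.coe_le_crossUCB_iff.1 h1 hj
  linarith [(hconf t).upper ks hks]

variable {τ : Fin K → ℝ}

/-- Two arms, one of them the best, cannot both be active once both have been sampled often. -/
lemma n_le_or_n_best_le (h : IsPath s B δ σ p) (hs : IsModel ν s) (hK : 2 ≤ K) (hb : IsBest ν ks)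
    (hconf : ∀ t, (σ t).Confident ν s B (δ / (2 * K)) ks) (hτ0 : ∀ k, 0 ≤ τ k)
    (hτ : ∀ k (n : ℕ), τ k < n → B n (δ / (2 * K)) ≤ gap ν ks k / 8) {t : ℕ} {k : Fin K}
    (hk : k ∈ (σ t).active) (hkks : k ≠ ks) : ((σ t).n k : ℝ) ≤ τ k ∨ ((σ t).n ks : ℝ) ≤ τ ks := by
  by_contra! hcon
  have hpos : ∀ j, τ j < (σ t).n j → 1 ≤ (σ t).n j := fun j hj => by
    exact_mod_cast (hτ0 j).trans_lt hj
  have h1 := h.mean_best_le_of_mem_active hs hb hconf hk (hpos _ hcon.2) (hpos _ hcon.1)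
  have h2 := (hconf t).lower k (hpos _ hcon.1)
  have h3 := hτ k _ hcon.1
  have h4 := hτ ks _ hcon.2
  have h5 := gap_best_le (ν := ν) hkks
  have h6 := hb.gap_pos hK k
  have h7 := gap_of_ne (ν := ν) hkks
  linarith

/-- If a non-competitive arm is active although the best arm has been sampled often, then its
pseudo-reward with respect to the best arm deviates by a constant. -/
lemma le_pseudoAvg_of_not_competitive (h : IsPath s B δ σ p) (hs : IsModel ν s) (hK : 2 ≤ K)
    (hb : IsBest ν ks) (hconf : ∀ t, (σ t).Confident ν s B (δ / (2 * K)) ks) (hτ0 : ∀ k, 0 ≤ τ k)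
    (hτ : ∀ k (n : ℕ), τ k < n → B n (δ / (2 * K)) ≤ gap ν ks k / 8) {t : ℕ} {k : Fin K}
    (hk : k ∈ (σ t).active) (hkC : k ∉ competitive ν s ks) (hn : τ ks < (σ t).n ks) :
    1 ≤ (σ t).n ks ∧ pseudoMean ν s k ks + gap ν ks ks / 2 ≤ (σ t).pseudoAvg k ks := by
  have hpos : 1 ≤ (σ t).n ks := by exact_mod_cast (hτ0 ks).trans_lt hn
  have h1 := h.mean_best_le_of_mem_active hs hb hconf hk hpos hpos
  have h2 := hτ ks _ hn
  have h3 := pseudoMean_lt_of_not_mem hK hkC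
  have h4 := hb.gap_pos hK ks
  exact ⟨hpos, by linarith⟩

/-- If the best arm is not sampled although no average deviates, then both indices of the second
sampled arm are at least the mean of the best arm. -/
lemma mean_best_le_indices (h : IsPath s B δ σ p) (hs : IsModel ν s) (hb : IsBest ν ks)
    (hconf : ∀ t, (σ t).Confident ν s B (δ / (2 * K)) ks) {t : ℕ} (ht : (σ t).Running)
    (hdev : ¬ Deviates ν s ks (t + 1) (σ t)) (h1 : ks ≠ (p t).1) :
    (mean ν ks : EReal) ≤ (σ t).crossUCB B (δ / (2 * K)) (p t).2 (p t).2 ∧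
      (mean ν ks : EReal) ≤ (σ t).pseudoUCBMin (t + 1) (p t).2 := by
  have hks : ks ∈ (σ t).active.erase (p t).1 :=
    Finset.mem_erase.2 ⟨h1, h.best_mem_active hs hb hconf t⟩
  have hmax := (h.choice t ht).2.2 ks hks
  rw [← le_min_iff]
  exact (le_min (State.coe_le_crossUCB_iff.2 ((hconf t).upper ks))
    (mean_le_pseudoUCBMin hs hdev)).trans hmax

lemma n_snd_le (h : IsPath s B δ σ p) (hs : IsModel ν s) (hK : 2 ≤ K) (hb : IsBest ν ks)
    (hconf : ∀ t, (σ t).Confident ν s B (δ / (2 * K)) ks) (hτ0 : ∀ k, 0 ≤ τ k)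
    (hτ : ∀ k (n : ℕ), τ k < n → B n (δ / (2 * K)) ≤ gap ν ks k / 8) {t : ℕ}
    (ht : (σ t).Running) (hdev : ¬ Deviates ν s ks (t + 1) (σ t)) (h1 : ks ≠ (p t).1)
    (h2 : ks ≠ (p t).2) : ((σ t).n (p t).2 : ℝ) ≤ τ (p t).2 := by
  by_contra! hcon
  have hpos : 1 ≤ (σ t).n (p t).2 := by exact_mod_cast (hτ0 _).trans_lt hcon
  have h3 := State.coe_le_crossUCB_iff.1 (h.mean_best_le_indices hs hb hconf ht hdev h1).1 hpos
  have h4 := (hconf t).lower _ hpos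
  have h5 := hτ _ _ hcon
  have h6 := gap_of_ne (ν := ν) h2.symm
  have h7 := hb.gap_pos hK (p t).2
  linarith

lemma mul_sq_le_of_le_radius {g : ℝ} (hg : 0 ≤ g) {t n : ℕ} (hle : g ≤ 2 * radius (t + 1) n) :
    n * g ^ 2 ≤ 8 * Real.log ((t : ℝ) + 1) := by
  have hlog : 0 ≤ Real.log ((t : ℝ) + 1) := Real.log_nonneg (by linarith [t.cast_nonneg (α := ℝ)])
  rcases Nat.eq_zero_or_pos n with rfl | hn
  · simpa using hlog
  · have hn' : (0 : ℝ) < n := by exact_mod_cast hn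
    have hsq : g ^ 2 ≤ (2 * radius (t + 1) n) ^ 2 := pow_le_pow_left₀ hg hle 2
    rw [mul_pow, radius, Real.sq_sqrt (by push_cast; positivity)] at hsq
    calc n * g ^ 2 ≤ n * (2 ^ 2 * (2 * Real.log ((t + 1 : ℕ) : ℝ) / n)) := by gcongr
      _ = 8 * Real.log ((t : ℝ) + 1) := by push_cast; field_simp; ring

/-- If the best arm is not sampled although no average deviates, then the second sampled arm has
been sampled rarely. -/
lemma n_snd_mul_sq_le (h : IsPath s B δ σ p) (hs : IsModel ν s) (hK : 2 ≤ K) (hb : IsBest ν ks)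
    (hconf : ∀ t, (σ t).Confident ν s B (δ / (2 * K)) ks) {t : ℕ}
    (ht : (σ t).Running) (hdev : ¬ Deviates ν s ks (t + 1) (σ t)) (h1 : ks ≠ (p t).1)
    (h2 : ks ≠ (p t).2) :
    ((σ t).n (p t).2 : ℝ) * gap ν ks ks ^ 2 ≤ 8 * Real.log ((t : ℝ) + 1) := by
  rcases Nat.eq_zero_or_pos ((σ t).n (p t).2) with h0 | hpos
  · rw [h0]
    simpa using Real.log_nonneg (by linarith [t.cast_nonneg (α := ℝ)] : (1 : ℝ) ≤ t + 1)
  · refine mul_sq_le_of_le_radius (hb.gap_pos hK ks).le ?_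
    have h3 := State.coe_le_pseudoUCB_iff.1 ((h.mean_best_le_indices hs hb hconf ht hdev h1).2.trans
      (iInf_le _ (p t).2)) hpos
    have h4 : ¬ _ := fun h' => hdev ⟨(p t).2, Or.inr (Or.inl ⟨hpos, h'⟩)⟩
    rw [hs.pseudoMean_self] at h4
    have h5 := gap_best_le (ν := ν) h2.symm
    have h6 := gap_of_ne (ν := ν) h2.symm
    linarith

/-- If, instead of the best arm, a non-competitive arm is sampled although no average deviates,
then the best arm has been sampled rarely. -/
lemma n_best_mul_sq_le (h : IsPath s B δ σ p) (hs : IsModel ν s) (hK : 2 ≤ K) (hb : IsBest ν ks)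
    (hconf : ∀ t, (σ t).Confident ν s B (δ / (2 * K)) ks) {t : ℕ}
    (ht : (σ t).Running) (hdev : ¬ Deviates ν s ks (t + 1) (σ t)) (h1 : ks ≠ (p t).1)
    (h2 : (p t).2 ∉ competitive ν s ks) :
    ((σ t).n ks : ℝ) * gap ν ks ks ^ 2 ≤ 8 * Real.log ((t : ℝ) + 1) := by
  rcases Nat.eq_zero_or_pos ((σ t).n ks) with h0 | hpos
  · rw [h0]
    simpa using Real.log_nonneg (by linarith [t.cast_nonneg (α := ℝ)] : (1 : ℝ) ≤ t + 1)
  · refine mul_sq_le_of_le_radius (hb.gap_pos hK ks).le ?_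
    have h3 := State.coe_le_pseudoUCB_iff.1 ((h.mean_best_le_indices hs hb hconf ht hdev h1).2.trans
      (iInf_le _ ks)) hpos
    have h4 : ¬ _ := fun h' => hdev ⟨(p t).2, Or.inr (Or.inr ⟨hpos, h'⟩)⟩
    have h5 := pseudoMean_lt_of_not_mem hK h2
    linarith

/-- A round without deviations samples a competitive arm with few samples, or it samples the best arm
while a pseudo-reward with respect to it deviates by a constant, or it wastes its second sample on a
non-competitive arm without sampling the best arm. -/
lemma round_cases (h : IsPath s B δ σ p) (hs : IsModel ν s) (hK : 2 ≤ K) (hb : IsBest ν ks)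
    (hconf : ∀ t, (σ t).Confident ν s B (δ / (2 * K)) ks) (hτ0 : ∀ k, 0 ≤ τ k)
    (hτ : ∀ k (n : ℕ), τ k < n → B n (δ / (2 * K)) ≤ gap ν ks k / 8) {t : ℕ}
    (ht : (σ t).Running) (hdev : ¬ Deviates ν s ks (t + 1) (σ t)) :
    (∃ k ∈ competitive ν s ks, (k = (p t).1 ∨ k = (p t).2) ∧ ((σ t).n k : ℝ) ≤ τ k) ∨
    (∃ k ∉ competitive ν s ks, (ks = (p t).1 ∨ ks = (p t).2) ∧
      1 ≤ (σ t).n ks ∧ pseudoMean ν s k ks + gap ν ks ks / 2 ≤ (σ t).pseudoAvg k ks) ∨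
    (ks ≠ (p t).1 ∧ ks ≠ (p t).2 ∧ (p t).2 ∉ competitive ν s ks) := by
  have hks := hs.best_mem_competitive hK hb
  -- the best arm is sampled together with `k`
  have both : ∀ k, k ∈ (σ t).active → k ≠ ks → (k = (p t).1 ∨ k = (p t).2) →
      (ks = (p t).1 ∨ ks = (p t).2) →
      (∃ k ∈ competitive ν s ks, (k = (p t).1 ∨ k = (p t).2) ∧ ((σ t).n k : ℝ) ≤ τ k) ∨
      (∃ k ∉ competitive ν s ks, (ks = (p t).1 ∨ ks = (p t).2) ∧
        1 ≤ (σ t).n ks ∧ pseudoMean ν s k ks + gap ν ks ks / 2 ≤ (σ t).pseudoAvg k ks) := by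
    intro k hk hkks hkp hksp
    by_cases hn : ((σ t).n ks : ℝ) ≤ τ ks
    · exact Or.inl ⟨ks, hks, hksp, hn⟩
    · by_cases hkC : k ∈ competitive ν s ks
      · exact Or.inl ⟨k, hkC, hkp,
          (h.n_le_or_n_best_le hs hK hb hconf hτ0 hτ hk hkks).resolve_right hn⟩
      · exact Or.inr ⟨k, hkC, hksp,
          h.le_pseudoAvg_of_not_competitive hs hK hb hconf hτ0 hτ hk hkC (not_le.1 hn)⟩
  have hact := h.choice_mem_active ht
  have hne := (h.choice t ht).ne
  by_cases h1 : ks = (p t).1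
  · rw [← or_assoc]
    exact Or.inl (both _ hact.2 (h1 ▸ hne) (Or.inr rfl) (Or.inl h1))
  by_cases h2 : ks = (p t).2
  · rw [← or_assoc]
    exact Or.inl (both _ hact.1 (h2 ▸ hne.symm) (Or.inl rfl) (Or.inr h2))
  by_cases h3 : (p t).2 ∈ competitive ν s ks
  · exact Or.inl ⟨_, h3, Or.inr rfl, h.n_snd_le hs hK hb hconf hτ0 hτ ht hdev h1 h2⟩
  · exact Or.inr (Or.inr ⟨h1, h2, h3⟩)

end IsPath

end Rounds

section Counting

open Classical

variable {σ : ℕ → State K} {p : ℕ → Fin K × Fin K}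

namespace IsPath

lemma card_sampled_le (h : IsPath s B δ σ p) (k : Fin K) (M : ℕ) :
    ((Finset.range M).filter fun t => (σ t).Running ∧ (k = (p t).1 ∨ k = (p t).2)).card ≤
      (σ M).n k := by
  have := Finset.card_le_card_of_injOn (s := (Finset.range M).filter fun t =>
    (σ t).Running ∧ (k = (p t).1 ∨ k = (p t).2)) (t := Finset.range ((σ M).n k))
    (fun t => (σ t).n k) (fun t ht => ?_)
    ((h.injOn_n k).mono fun t ht => (Finset.mem_filter.1 ht).2)
  · simpa using this
  · obtain ⟨htM, ht⟩ := Finset.mem_filter.1 ht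
    have h1 := h.n_succ_of_mem ht.1 ht.2
    have h2 : (σ (t + 1)).n k ≤ (σ M).n k := h.n_mono k (Finset.mem_range.1 htM)
    exact Finset.mem_coe.2 (Finset.mem_range.2 (show (σ t).n k < (σ M).n k by omega))

lemma card_rarely_sampled_le (h : IsPath s B δ σ p) (k : Fin K) (M : ℕ) {a : ℝ} (ha : 0 ≤ a) :
    (((Finset.range M).filter fun t => ((σ t).Running ∧ (k = (p t).1 ∨ k = (p t).2)) ∧
      ((σ t).n k : ℝ) ≤ a).card : ℝ) ≤ a + 1 := by
  have := Finset.card_le_card_of_injOn (s := (Finset.range M).filter fun t =>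
    ((σ t).Running ∧ (k = (p t).1 ∨ k = (p t).2)) ∧ ((σ t).n k : ℝ) ≤ a)
    (t := Finset.range (⌊a⌋₊ + 1))
    (fun t => (σ t).n k) (fun t ht => ?_)
    ((h.injOn_n k).mono fun t ht => (Finset.mem_filter.1 ht).2.1)
  · rw [Finset.card_range] at this
    calc _ ≤ ((⌊a⌋₊ + 1 : ℕ) : ℝ) := by exact_mod_cast this
      _ ≤ a + 1 := by push_cast; linarith [Nat.floor_le ha]
  · have := Nat.le_floor (Finset.mem_filter.1 ht).2.2
    exact Finset.mem_coe.2 (Finset.mem_range.2 (show (σ t).n k < ⌊a⌋₊ + 1 by omega))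

lemma card_best_sampled_le (h : IsPath s B δ σ p) (k : Fin K) (M : ℕ) (a : ℝ) :
    ((Finset.range M).filter fun t => ((σ t).Running ∧ (ks = (p t).1 ∨ ks = (p t).2)) ∧
      1 ≤ (σ t).n ks ∧ a ≤ (σ t).pseudoAvg k ks).card ≤
    ((Finset.range M).filter fun n => ∃ t, (σ t).n ks = n + 1 ∧ a ≤ (σ t).pseudoAvg k ks).card := by
  refine Finset.card_le_card_of_injOn (fun t => (σ t).n ks - 1) (fun t ht => ?_) fun t ht u hu htu =>
    h.injOn_n ks (Finset.mem_filter.1 ht).2.1 (Finset.mem_filter.1 hu).2.1 ?_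
  · obtain ⟨htM, -, h1, h2⟩ := Finset.mem_filter.1 ht
    have := h.n_le t ks
    have := Finset.mem_range.1 htM
    exact Finset.mem_coe.2 (Finset.mem_filter.2
      ⟨Finset.mem_range.2 (show (σ t).n ks - 1 < M by omega), t,
        show (σ t).n ks = (σ t).n ks - 1 + 1 by omega, h2⟩)
  · have h1 := (Finset.mem_filter.1 ht).2.2.1
    have h2 := (Finset.mem_filter.1 hu).2.2.1
    simp only at htu ⊢
    omega

variable [IsProbabilityMeasure ν]

/-- A late round in which a non-competitive arm is sampled instead of the best arm, although no
average deviates, comes after deviations in half of the rounds: in the other rounds, either the best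
arm is sampled, or another arm that has been sampled rarely. -/
lemma succ_le_two_mul_card_deviates (h : IsPath s B δ σ p) (hs : IsModel ν s) (hK : 2 ≤ K)
    (hb : IsBest ν ks) (hconf : ∀ t, (σ t).Confident ν s B (δ / (2 * K)) ks) {t : ℕ}
    (ht : (σ t).Running) (hdev : ¬ Deviates ν s ks (t + 1) (σ t)) (h1 : ks ≠ (p t).1)
    (h2 : (p t).2 ∉ competitive ν s ks) (hlog : 1 ≤ Real.log ((t : ℝ) + 1))
    (hlate : 32 * K * Real.log ((t : ℝ) + 1) ≤ ((t : ℝ) + 1) * gap ν ks ks ^ 2) :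
    (t : ℝ) + 1 ≤ 2 * ((Finset.range t).filter fun u => Deviates ν s ks (u + 1) (σ u)).card := by
  have hK' : (2 : ℝ) ≤ K := by exact_mod_cast hK
  set T : ℝ := (t : ℝ) + 1 with hT
  have hT0 : 0 < T := by positivity
  set g := gap ν ks ks with hg
  have hg0 : 0 < g := hb.gap_pos hK ks
  have hg1 : g ≤ 1 := hs.gap_le_one hK ks ks
  have hrare : ∀ n : ℕ, n * g ^ 2 ≤ 8 * Real.log T → (n : ℝ) ≤ T / (4 * K) := fun n hn => by
    rw [le_div_iff₀ (by positivity)]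
    have : (n * (4 * K)) * g ^ 2 ≤ T * g ^ 2 := by
      calc (n * (4 * K)) * g ^ 2 = 4 * K * (n * g ^ 2) := by ring
        _ ≤ 4 * K * (8 * Real.log T) := by gcongr
        _ = 32 * K * Real.log T := by ring
        _ ≤ T * g ^ 2 := hlate
    exact le_of_mul_le_mul_right this (by positivity)
  have hKT : 32 * (K : ℝ) ≤ T := by
    calc 32 * (K : ℝ) ≤ 32 * K * Real.log T := le_mul_of_one_le_right (by positivity) hlog
      _ ≤ T * g ^ 2 := hlate
      _ ≤ T := mul_le_of_le_one_right hT0.le (pow_le_one₀ hg0.le hg1)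
  set D := (Finset.range t).filter fun u => Deviates ν s ks (u + 1) (σ u)
  set S := (Finset.range t).filter fun u => (σ u).Running ∧ (ks = (p u).1 ∨ ks = (p u).2)
  set R : Fin K → Finset ℕ := fun k => (Finset.range t).filter fun u =>
    ((σ u).Running ∧ (k = (p u).1 ∨ k = (p u).2)) ∧ ((σ u).n k : ℝ) ≤ T / (4 * K)
  have hcover : Finset.range t ⊆ D ∪ (S ∪ (Finset.univ.erase ks).biUnion R) := by
    intro u hu
    have hut := Finset.mem_range.1 hu
    by_cases hD : Deviates ν s ks (u + 1) (σ u)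
    · exact Finset.mem_union_left _ (Finset.mem_filter.2 ⟨hu, hD⟩)
    refine Finset.mem_union_right _ ?_
    have hru := h.running_of_le hut.le ht
    by_cases hS : ks = (p u).1 ∨ ks = (p u).2
    · exact Finset.mem_union_left _ (Finset.mem_filter.2 ⟨hu, hru, hS⟩)
    obtain ⟨hS1, hS2⟩ := not_or.1 hS
    refine Finset.mem_union_right _ (Finset.mem_biUnion.2 ⟨(p u).2,
      Finset.mem_erase.2 ⟨Ne.symm hS2, Finset.mem_univ _⟩,
      Finset.mem_filter.2 ⟨hu, ⟨hru, Or.inr rfl⟩, hrare _ ?_⟩⟩)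
    refine (h.n_snd_mul_sq_le hs hK hb hconf hru hD hS1 hS2).trans ?_
    have : (u : ℝ) + 1 ≤ T := by rw [hT]; gcongr
    gcongr
  have hcard : t ≤ D.card + (S.card + ∑ k ∈ Finset.univ.erase ks, (R k).card) := by
    calc t = (Finset.range t).card := (Finset.card_range t).symm
      _ ≤ _ := Finset.card_le_card hcover
      _ ≤ _ := (Finset.card_union_le _ _).trans (add_le_add le_rfl
        ((Finset.card_union_le _ _).trans (add_le_add le_rfl Finset.card_biUnion_le)))
  have hcard' : (t : ℝ) ≤ D.card + (S.card + ∑ k ∈ Finset.univ.erase ks, ((R k).card : ℝ)) := by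
    exact_mod_cast hcard
  have hS : (S.card : ℝ) ≤ T / (4 * K) :=
    (Nat.cast_le.2 (h.card_sampled_le ks t)).trans
      (hrare _ (h.n_best_mul_sq_le hs hK hb hconf ht hdev h1 h2))
  have hR : ∑ k ∈ Finset.univ.erase ks, ((R k).card : ℝ) ≤ (K - 1) * (T / (4 * K) + 1) := by
    calc _ ≤ ∑ k ∈ Finset.univ.erase ks, (T / (4 * K) + 1) :=
          Finset.sum_le_sum fun k _ => h.card_rarely_sampled_le k t (by positivity)
      _ = _ := by
          rw [Finset.sum_const, Finset.card_erase_of_mem (Finset.mem_univ ks), Finset.card_univ,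
            Fintype.card_fin, nsmul_eq_mul, Nat.cast_sub (by omega), Nat.cast_one]
  have hsplit : T / (4 * K) + (K - 1) * (T / (4 * K) + 1) = T / 4 + K - 1 := by
    field_simp
    ring
  linarith

/-- The rounds played are covered by competitive arms with few samples, deviating rounds, rounds after
which half of the rounds have deviated, and constant deviations of pseudo-rewards with respect to the
best arm, the last ones indexed by the sample size at which they occur. -/
lemma card_running_le (h : IsPath s B δ σ p) (hs : IsModel ν s) (hK : 2 ≤ K) (hb : IsBest ν ks)
    (hconf : ∀ t, (σ t).Confident ν s B (δ / (2 * K)) ks) {τ : Fin K → ℝ} (hτ0 : ∀ k, 0 ≤ τ k)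
    (hτ : ∀ k (n : ℕ), τ k < n → B n (δ / (2 * K)) ≤ gap ν ks k / 8) {T₀ : ℝ} (hT₀ : 0 ≤ T₀)
    (hlate : ∀ T, T₀ < T → (∃ k, k ∉ competitive ν s ks) →
      1 ≤ Real.log T ∧ 32 * K * Real.log T ≤ T * gap ν ks ks ^ 2) (M : ℕ) :
    (((Finset.range M).filter fun t => (σ t).Running).card : ℝ) ≤
      ∑ k ∈ competitive ν s ks, (τ k + 1) + T₀ +
      3 * ((Finset.range M).filter fun t => Deviates ν s ks (t + 1) (σ t)).card +
      ∑ k ∈ (competitive ν s ks)ᶜ, (((Finset.range M).filter fun n => ∃ t, (σ t).n ks = n + 1 ∧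
        pseudoMean ν s k ks + gap ν ks ks / 2 ≤ (σ t).pseudoAvg k ks).card : ℝ) := by
  set D := (Finset.range M).filter fun t => Deviates ν s ks (t + 1) (σ t)
  set R : Fin K → Finset ℕ := fun k => (Finset.range M).filter fun t =>
    ((σ t).Running ∧ (k = (p t).1 ∨ k = (p t).2)) ∧ ((σ t).n k : ℝ) ≤ τ k
  set V : Fin K → Finset ℕ := fun k => (Finset.range M).filter fun t =>
    ((σ t).Running ∧ (ks = (p t).1 ∨ ks = (p t).2)) ∧ 1 ≤ (σ t).n ks ∧
      pseudoMean ν s k ks + gap ν ks ks / 2 ≤ (σ t).pseudoAvg k ks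
  set Q := (Finset.range M).filter fun t : ℕ => (t : ℝ) + 1 ≤ T₀ + 2 * D.card
  have hcover : ((Finset.range M).filter fun t => (σ t).Running) ⊆
      ((competitive ν s ks).biUnion R ∪ (competitive ν s ks)ᶜ.biUnion V) ∪ (Q ∪ D) := by
    intro t ht
    obtain ⟨htM, hr⟩ := Finset.mem_filter.1 ht
    by_cases hD : Deviates ν s ks (t + 1) (σ t)
    · exact Finset.mem_union_right _ (Finset.mem_union_right _ (Finset.mem_filter.2 ⟨htM, hD⟩))
    rcases h.round_cases hs hK hb hconf hτ0 hτ hr hD with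
      ⟨k, hk, hkp, hn⟩ | ⟨k, hk, hkp, hn⟩ | ⟨h1, h2, h3⟩
    · exact Finset.mem_union_left _ (Finset.mem_union_left _
        (Finset.mem_biUnion.2 ⟨k, hk, Finset.mem_filter.2 ⟨htM, ⟨hr, hkp⟩, hn⟩⟩))
    · exact Finset.mem_union_left _ (Finset.mem_union_right _ (Finset.mem_biUnion.2
        ⟨k, Finset.mem_compl.2 hk, Finset.mem_filter.2 ⟨htM, ⟨hr, hkp⟩, hn⟩⟩))
    · refine Finset.mem_union_right _ (Finset.mem_union_left _ (Finset.mem_filter.2 ⟨htM, ?_⟩))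
      rcases le_or_gt ((t : ℝ) + 1) T₀ with hle | hlt
      · linarith [D.card.cast_nonneg (α := ℝ)]
      · obtain ⟨hl1, hl2⟩ := hlate _ hlt ⟨_, h3⟩
        have hle := h.succ_le_two_mul_card_deviates hs hK hb hconf hr hD h1 h3 hl1 hl2
        have hsub : ((Finset.range t).filter fun u => Deviates ν s ks (u + 1) (σ u)).card ≤
            D.card := Finset.card_le_card (Finset.filter_subset_filter _
              (Finset.range_subset_range.2 (Finset.mem_range.1 htM).le))
        have hsub' := (Nat.cast_le (α := ℝ)).2 hsub
        linarith
  have hQ : (Q.card : ℝ) ≤ T₀ + 2 * D.card := by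
    have hx : 0 ≤ T₀ + 2 * (D.card : ℝ) := by positivity
    have hsub : Q ⊆ Finset.range ⌊T₀ + 2 * (D.card : ℝ)⌋₊ := fun t ht => by
      have := (Finset.mem_filter.1 ht).2
      have h' : t + 1 ≤ ⌊T₀ + 2 * (D.card : ℝ)⌋₊ := Nat.le_floor (by push_cast; exact this)
      exact Finset.mem_range.2 h'
    calc (Q.card : ℝ) ≤ ⌊T₀ + 2 * (D.card : ℝ)⌋₊ := by
          exact_mod_cast (Finset.card_le_card hsub).trans_eq (Finset.card_range _)
      _ ≤ _ := Nat.floor_le hx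
  have hcard : (((Finset.range M).filter fun t => (σ t).Running).card : ℝ) ≤
      (∑ k ∈ competitive ν s ks, ((R k).card : ℝ) +
        ∑ k ∈ (competitive ν s ks)ᶜ, ((V k).card : ℝ)) + (Q.card + D.card) := by
    exact_mod_cast (Finset.card_le_card hcover).trans ((Finset.card_union_le _ _).trans
      (add_le_add ((Finset.card_union_le _ _).trans
        (add_le_add Finset.card_biUnion_le Finset.card_biUnion_le)) (Finset.card_union_le _ _)))
  have hR : ∑ k ∈ competitive ν s ks, ((R k).card : ℝ) ≤ ∑ k ∈ competitive ν s ks, (τ k + 1) :=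
    Finset.sum_le_sum fun k _ => h.card_rarely_sampled_le k M (hτ0 k)
  have hV := Finset.sum_le_sum fun k (_ : k ∈ (competitive ν s ks)ᶜ) =>
    (Nat.cast_le (α := ℝ)).2 (h.card_best_sampled_le (ks := ks) k M
      (pseudoMean ν s k ks + gap ν ks ks / 2))
  linarith

end IsPath

end Counting

end CorrBandit

/-! ### Confidence widths, the threshold, and the expected number of samples -/

namespace CorrBandit

section Widths

lemma one_le_log_of_three_le {x : ℝ} (hx : 3 ≤ x) : 1 ≤ Real.log x := by
  rw [Real.le_log_iff_exp_le (by linarith)]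
  linarith [Real.exp_one_lt_d9]

/-- An explicit solution of `A log (D log (x / Δ²)) ≤ x`. -/
lemma mul_log_mul_log_le {A D Δ x : ℝ} (hA : 1 ≤ A) (hD : 4 ≤ D) (hΔ : 0 < Δ)
    (hΔ1 : Δ ≤ 1) (hx : 64 * A ^ 2 * Real.log (D * max 1 (Real.log (1 / Δ ^ 2))) ≤ x) :
    A * Real.log (D * Real.log (x / Δ ^ 2)) ≤ x := by
  set M := max 1 (Real.log (1 / Δ ^ 2)) with hM
  have hM1 : 1 ≤ M := le_max_left _ _
  set L := Real.log (D * M) with hL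
  have hL1 : 1 ≤ L := one_le_log_of_three_le (by nlinarith)
  have hA2 : 1 ≤ A ^ 2 := one_le_pow₀ hA
  have hx1 : 64 * A ^ 2 ≤ x := le_trans (le_mul_of_one_le_right (by positivity) hL1) hx
  have hx0 : 0 < x := by linarith
  have hlx : 1 ≤ Real.log x := one_le_log_of_three_le (by linarith)
  have hΔ2 : 0 ≤ Real.log (1 / Δ ^ 2) :=
    Real.log_nonneg ((one_le_div (by positivity)).2 (pow_le_one₀ hΔ.le hΔ1))
  have hlog : Real.log (x / Δ ^ 2) = Real.log x + Real.log (1 / Δ ^ 2) := by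
    rw [← Real.log_mul hx0.ne' (by positivity), mul_one_div]
  have hle : Real.log (x / Δ ^ 2) ≤ M * (2 * Real.log x) := by
    have : Real.log (1 / Δ ^ 2) ≤ M := le_max_right _ _
    rw [hlog]
    nlinarith
  have hpos : 0 < Real.log (x / Δ ^ 2) := by rw [hlog]; linarith
  have h1 : Real.log (D * Real.log (x / Δ ^ 2)) ≤ L + 4 * √x := by
    calc Real.log (D * Real.log (x / Δ ^ 2)) ≤ Real.log ((D * M) * (2 * Real.log x)) := by
          refine Real.log_le_log (by positivity) ?_
          rw [mul_assoc]
          gcongr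
      _ = L + Real.log (2 * Real.log x) := by
          rw [Real.log_mul (by positivity) (by positivity)]
      _ ≤ L + 2 * Real.log x := by
          gcongr
          exact Real.log_le_self (by positivity)
      _ = L + 4 * Real.log √x := by rw [Real.log_sqrt hx0.le]; ring
      _ ≤ L + 4 * √x := by
          gcongr
          exact Real.log_le_self (Real.sqrt_nonneg x)
  have hsq : 8 * A ≤ √x := Real.le_sqrt_of_sq_le (by nlinarith)
  have hss : √x * √x = x := Real.mul_self_sqrt hx0.le
  have h2 : 8 * A * √x ≤ x := by nlinarith [Real.sqrt_nonneg x]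
  have h3 : 2 * (A * L) ≤ x := by
    have : A ≤ A ^ 2 := by nlinarith
    nlinarith
  calc A * Real.log (D * Real.log (x / Δ ^ 2)) ≤ A * (L + 4 * √x) := by gcongr
    _ ≤ x := by linarith

/-- Beyond this sample size a confidence width of rate `c` at level `1 / D` is at most `Δ / 8`. The
constant `max |c| 1` replaces `c`, which the rate allows to have any sign. -/
noncomputable def enoughSamples (c D Δ : ℝ) : ℝ :=
  64 * (64 * max |c| 1 ^ 2) ^ 2 / Δ ^ 2 * Real.log (D * max 1 (Real.log (1 / Δ ^ 2)))

variable {c D Δ : ℝ}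

lemma le_enoughSamples (c : ℝ) (hD : 4 ≤ D) (hΔ : 0 < Δ) (hΔ1 : Δ ≤ 1) :
    64 ≤ enoughSamples c D Δ := by
  have hL : 1 ≤ Real.log (D * max 1 (Real.log (1 / Δ ^ 2))) :=
    one_le_log_of_three_le (by nlinarith [le_max_left 1 (Real.log (1 / Δ ^ 2))])
  have hc : 1 ≤ max |c| 1 ^ 2 := one_le_pow₀ (le_max_right _ _)
  have hA : 1 ≤ (64 * max |c| 1 ^ 2) ^ 2 := one_le_pow₀ (by linarith)
  have hΔ2 : Δ ^ 2 ≤ 1 := pow_le_one₀ hΔ.le hΔ1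
  have h1 : 64 ≤ 64 * (64 * max |c| 1 ^ 2) ^ 2 / Δ ^ 2 := by
    rw [le_div_iff₀ (by positivity)]
    nlinarith
  exact h1.trans (le_mul_of_one_le_right (by linarith) hL)

lemma width_le_of_enoughSamples_lt {B : ℕ → ℝ → ℝ} (hB : HasLILRate c B) {ε : ℝ} (hε : 0 < ε)
    (hε1 : ε ≤ 1 / 4) (hΔ : 0 < Δ) (hΔ1 : Δ ≤ 1) {n : ℕ} (hn : enoughSamples c (1 / ε) Δ < n) :
    B n ε ≤ Δ / 8 := by
  have hD : 4 ≤ 1 / ε := by rw [le_div_iff₀ hε]; linarith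
  have hn64 := (le_enoughSamples c hD hΔ hΔ1).trans hn.le
  have hn0 : (0 : ℝ) < n := by linarith
  have hn3 : 3 ≤ n := by exact_mod_cast (by linarith : (3 : ℝ) ≤ n)
  set c' := max |c| 1 with hc'
  have hc1 : 1 ≤ c' := le_max_right _ _
  have hcc : c ≤ c' := (le_abs_self c).trans (le_max_left _ _)
  have hkey := mul_log_mul_log_le (A := 64 * c' ^ 2) (D := 1 / ε) (Δ := Δ) (x := n * Δ ^ 2)
    (by nlinarith) hD hΔ hΔ1 (by
      rw [enoughSamples, div_mul_eq_mul_div, div_lt_iff₀ (by positivity)] at hn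
      exact hn.le)
  rw [mul_div_cancel_right₀ _ (by positivity), one_div_mul_eq_div] at hkey
  calc B n ε ≤ c * √(Real.log (Real.log n / ε) / n) := hB n ε hn3 hε (by linarith)
    _ ≤ c' * √(Real.log (Real.log n / ε) / n) := by gcongr
    _ ≤ c' * (Δ / (8 * c')) := by
        gcongr
        rw [Real.sqrt_le_left (by positivity), div_le_iff₀ hn0]
        rw [div_pow, mul_pow, div_mul_eq_mul_div, le_div_iff₀ (by positivity)]
        linarith
    _ = Δ / 8 := by field_simp

end Widths

section Threshold

variable {K : ℕ} {ν : Measure (Fin K → ℝ)} {s : Fin K → Fin K → ℝ → ℝ} {ks : Fin K}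

lemma tZero_eq_two (h : ¬ ∃ k, k ∉ competitive ν s ks) : tZero ν s ks = 2 := by
  have : {τ : ℝ | 2 ≤ τ ∧ ∀ k, k ∉ competitive ν s ks →
      4 * √(2 * K * Real.log τ / τ) ≤ gap ν ks ks} = Set.Ici 2 := by
    ext τ
    exact ⟨fun h' => h'.1, fun h' => ⟨h', fun k hk => absurd ⟨k, hk⟩ h⟩⟩
  rw [tZero, this, csInf_Ici]

lemma mul_log_le_of_threshold (hK : 2 ≤ K) {g τ : ℝ} (hg : 0 < g) (hg1 : g ≤ 1) (hτ : 2 ≤ τ)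
    (h : 4 * √(2 * K * Real.log τ / τ) ≤ g) :
    3 ≤ τ ∧ 32 * K * Real.log τ ≤ τ * g ^ 2 := by
  have hK' : (2 : ℝ) ≤ K := by exact_mod_cast hK
  have hlog : Real.log 2 ≤ Real.log τ := Real.log_le_log (by norm_num) hτ
  have hl2 := Real.log_two_gt_d9
  have hτ0 : 0 < τ := by linarith
  have hlog0 : 0 ≤ Real.log τ := by linarith
  have hsq : (4 * √(2 * K * Real.log τ / τ)) ^ 2 ≤ g ^ 2 := pow_le_pow_left₀ (by positivity) h 2
  rw [mul_pow, Real.sq_sqrt (by positivity)] at hsq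
  have h32 : 32 * K * Real.log τ ≤ τ * g ^ 2 := by
    calc 32 * K * Real.log τ = τ * (4 ^ 2 * (2 * K * Real.log τ / τ)) := by field_simp; ring
      _ ≤ τ * g ^ 2 := by gcongr
  refine ⟨?_, h32⟩
  have : τ * g ^ 2 ≤ τ := mul_le_of_le_one_right hτ0.le (pow_le_one₀ hg.le hg1)
  nlinarith

lemma tZero_spec [IsProbabilityMeasure ν] (hs : IsModel ν s) (hK : 2 ≤ K) (hb : IsBest ν ks)
    (h : ∃ k, k ∉ competitive ν s ks) :
    32 * K ≤ tZero ν s ks * gap ν ks ks ^ 2 ∧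
    ∀ T, tZero ν s ks < T →
      1 ≤ Real.log T ∧ 32 * K * Real.log T ≤ T * gap ν ks ks ^ 2 := by
  have hK' : (2 : ℝ) ≤ K := by exact_mod_cast hK
  set g := gap ν ks ks with hg
  have hg0 : 0 < g := hb.gap_pos hK ks
  have hg1 : g ≤ 1 := hs.gap_le_one hK ks ks
  set S := {τ : ℝ | 2 ≤ τ ∧ ∀ k, k ∉ competitive ν s ks → 4 * √(2 * K * Real.log τ / τ) ≤ g}
    with hS
  have hmem : ∀ τ ∈ S, 3 ≤ τ ∧ 32 * K * Real.log τ ≤ τ * g ^ 2 := fun τ hτ => by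
    obtain ⟨k, hk⟩ := h
    exact mul_log_le_of_threshold hK hg0 hg1 hτ.1 (hτ.2 k hk)
  have hne : S.Nonempty := by
    have hev := (Real.isLittleO_log_id_atTop.bound
      (c := g ^ 2 / (32 * K)) (by positivity)).and (Filter.eventually_ge_atTop 2)
    obtain ⟨τ, hτ, hτ2⟩ := hev.exists
    refine ⟨τ, hτ2, fun _ _ => ?_⟩
    have hτ0 : 0 < τ := by linarith
    have hlog : Real.log τ ≤ g ^ 2 / (32 * K) * τ := by
      have := (le_abs_self _).trans hτ
      rwa [id, Real.norm_eq_abs, abs_of_pos hτ0] at this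
    have : √(2 * K * Real.log τ / τ) ≤ g / 4 := by
      rw [Real.sqrt_le_left (by positivity), div_le_iff₀ hτ0]
      calc 2 * K * Real.log τ ≤ 2 * K * (g ^ 2 / (32 * K) * τ) := by gcongr
        _ = (g / 4) ^ 2 * τ := by field_simp; norm_num
    linarith
  constructor
  · have : 32 * K / g ^ 2 ≤ sInf S := le_csInf hne fun τ hτ => by
      obtain ⟨h3, h32⟩ := hmem τ hτ
      rw [div_le_iff₀ (by positivity)]
      exact (le_mul_of_one_le_right (by positivity) (one_le_log_of_three_le h3)).trans h32
    rwa [div_le_iff₀ (by positivity)] at this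
  · intro T hT
    obtain ⟨τ, hτ, hτT⟩ := (csInf_lt_iff ⟨2, fun τ hτ => hτ.1⟩ hne).1 hT
    obtain ⟨h3, h32⟩ := hmem τ hτ
    have hT0 : 0 < T := by linarith
    have hτ0 : 0 < τ := by linarith
    refine ⟨one_le_log_of_three_le (by linarith), ?_⟩
    -- `log x / x` decreases beyond `e`
    have he : Real.exp 1 ≤ τ := by linarith [Real.exp_one_lt_d9]
    have hanti : Real.log T / T ≤ Real.log τ / τ :=
      Real.log_div_self_antitoneOn he (he.trans hτT.le) hτT.le
    rw [div_le_div_iff₀ hT0 hτ0] at hanti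
    have : (32 * K * Real.log T) * τ ≤ (T * g ^ 2) * τ := by
      calc (32 * K * Real.log T) * τ = 32 * K * (Real.log T * τ) := by ring
        _ ≤ 32 * K * (Real.log τ * T) := by gcongr
        _ = (32 * K * Real.log τ) * T := by ring
        _ ≤ (τ * g ^ 2) * T := by gcongr
        _ = (T * g ^ 2) * τ := by ring
    exact le_of_mul_le_mul_right this hτ0

/-- The expected number of rounds that competitive arms do not account for is within the claimed
remainder. The term `9 * K` stands for three rounds per deviating round. A non-competitive arm forces
`t₀ ≥ 32 K / Δ²`, so that `t₀` dominates all other terms; otherwise `t₀ = 2` and the cubic term is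
needed. -/
lemma remainder_le [IsProbabilityMeasure ν] (hs : IsModel ν s) (hK : 2 ≤ K) (hb : IsBest ν ks) :
    0 ≤ tZero ν s ks ∧
    tZero ν s ks + 9 * K + ∑ _k ∈ (competitive ν s ks)ᶜ, 1 / (2 * (gap ν ks ks / 2) ^ 2) ≤
      (3 * K + 2 * K * tZero ν s ks) / 2 +
        (((K : ℝ) + 1) ^ 3 / tZero ν s ks + 2 / tZero ν s ks ^ 2) := by
  have hK' : (2 : ℝ) ≤ K := by exact_mod_cast hK
  by_cases h : ∃ k, k ∉ competitive ν s ks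
  · have h32 := (tZero_spec hs hK hb h).1
    set g := gap ν ks ks with hg
    have hg0 : 0 < g := hb.gap_pos hK ks
    have hg1 : g ≤ 1 := hs.gap_le_one hK ks ks
    set T := tZero ν s ks
    have hT : 0 < T := by
      by_contra! hT
      nlinarith [mul_nonneg_of_nonpos_of_nonpos hT (neg_nonpos.2 (sq_nonneg g))]
    have hKT : 32 * (K : ℝ) ≤ T := h32.trans (mul_le_of_le_one_right hT.le (pow_le_one₀ hg0.le hg1))
    have hsum : ∑ _k ∈ (competitive ν s ks)ᶜ, 1 / (2 * (g / 2) ^ 2) ≤ T / 16 := by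
      rw [Finset.sum_const, nsmul_eq_mul]
      have hcard : (((competitive ν s ks)ᶜ.card : ℕ) : ℝ) ≤ K := by
        exact_mod_cast (Finset.card_le_univ _).trans_eq (Fintype.card_fin K)
      calc _ ≤ (K : ℝ) * (1 / (2 * (g / 2) ^ 2)) := by gcongr
        _ = 32 * K / g ^ 2 / 16 := by field_simp; norm_num
        _ ≤ T / 16 := by
            gcongr
            rwa [div_le_iff₀ (by positivity)]
    have hrest : 0 ≤ ((K : ℝ) + 1) ^ 3 / T + 2 / T ^ 2 := by positivity
    refine ⟨hT.le, ?_⟩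
    nlinarith
  · have hC : (competitive ν s ks)ᶜ = ∅ := by
      rw [Finset.eq_empty_iff_forall_notMem]
      exact fun k hk => h ⟨k, Finset.mem_compl.1 hk⟩
    rw [hC, tZero_eq_two h, Finset.sum_empty]
    refine ⟨by norm_num, ?_⟩
    have h2 : 0 ≤ ((K : ℝ) - 2) := by linarith
    have h3 := mul_nonneg h2 h2
    have h4 := mul_nonneg h3 h2
    nlinarith

end Threshold

section Expectation

variable {K : ℕ} {ν : Measure (Fin K → ℝ)} [IsProbabilityMeasure ν]
  {s : Fin K → Fin K → ℝ → ℝ} {B : ℕ → ℝ → ℝ} {δ : ℝ} {ks : Fin K}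
  {Ω : Type*} [mΩ : MeasurableSpace Ω] {P : Measure Ω} [IsProbabilityMeasure P]
  {ℱ : Filtration ℕ mΩ} {m : ℕ → Ω → Fin K × Fin K} {X Y : ℕ → Ω → Fin K → ℝ}

lemma ofReal_add_natCast_sum {ι : Type*} {a b : ℝ} (ha : 0 ≤ a) (hb : 0 ≤ b) (d : ℕ)
    (I : Finset ι) (v : ι → ℕ) : ENNReal.ofReal (a + b + 3 * d + ∑ i ∈ I, (v i : ℝ)) =
      ENNReal.ofReal a + (ENNReal.ofReal b + (3 * d + ∑ i ∈ I, (v i : ENNReal))) := by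
  have hsum : 0 ≤ ∑ i ∈ I, (v i : ℝ) := Finset.sum_nonneg fun i _ => (v i).cast_nonneg
  rw [ENNReal.ofReal_add (by positivity) hsum, ENNReal.ofReal_add (by positivity) (by positivity),
    ENNReal.ofReal_add ha hb, ENNReal.ofReal_mul (by norm_num),
    ENNReal.ofReal_sum_of_nonneg fun i _ => (v i).cast_nonneg]
  simp only [ENNReal.ofReal_natCast, ENNReal.ofReal_ofNat, add_assoc]

/-- The expected number of rounds among the first `M` that are played on the good event. -/
lemma sum_measure_running_le (hK : 2 ≤ K) (hs : IsModel ν s) (hb : IsBest ν ks)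
    (hrun : IsCLUCBRun ν s B δ P ℱ m X Y) {τ : Fin K → ℝ} (hτ0 : ∀ k, 0 ≤ τ k)
    (hτ : ∀ k (n : ℕ), τ k < n → B n (δ / (2 * K)) ≤ gap ν ks k / 8) (M : ℕ) :
    ∑ t ∈ Finset.range M, P.restrict (goodEvent ν s B δ ks m X Y)
        {ω | (randState s B δ m X Y t ω).Running} ≤
      ENNReal.ofReal (∑ k ∈ competitive ν s ks, (τ k + 1)) * P (goodEvent ν s B δ ks m X Y) +
      ENNReal.ofReal (tZero ν s ks + 9 * K +
        ∑ _k ∈ (competitive ν s ks)ᶜ, 1 / (2 * (gap ν ks ks / 2) ^ 2)) := by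
  classical
  set E := goodEvent ν s B δ ks m X Y with hE
  set σ := randState s B δ m X Y with hσ
  set a := ∑ k ∈ competitive ν s ks, (τ k + 1) with ha
  have ha0 : 0 ≤ a := Finset.sum_nonneg fun k _ => by linarith [hτ0 k]
  have hE' : MeasurableSet E := measurableSet_goodEvent hrun hs.measurable
  have hT0 := (remainder_le (ν := ν) (s := s) hs hK hb).1
  have hg0 := hb.gap_pos hK ks
  -- measurable hulls make the measurability of these events irrelevant
  let D : ℕ → Set Ω := fun t => toMeasurable P {ω | Deviates ν s ks (t + 1) (σ t ω)}
  let V : Fin K → ℕ → Set Ω := fun k n => toMeasurable P {ω | ∃ t, (σ t ω).n ks = n + 1 ∧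
    pseudoMean ν s k ks + gap ν ks ks / 2 ≤ (σ t ω).pseudoAvg k ks}
  have hR : ∀ t, MeasurableSet {ω | (σ t ω).Running} := fun t =>
    ((hrun.measurableState hs.measurable t).mono (ℱ.le t)).measurableSet_running
  have hcount : ∀ (Q : ℕ → Ω → Prop) (ω : Ω),
      (((Finset.range M).filter fun t => Q t ω).card : ENNReal) =
        ∑ t ∈ Finset.range M, {ω | Q t ω}.indicator 1 ω := fun Q ω => by
    rw [Finset.card_filter]
    push_cast
    exact Finset.sum_congr rfl fun t _ => by simp [Set.indicator_apply]
  have hpoint : ∀ ω ∈ E, ∑ t ∈ Finset.range M, {ω | (σ t ω).Running}.indicator 1 ω ≤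
      ENNReal.ofReal a + (ENNReal.ofReal (tZero ν s ks) +
        (3 * ∑ t ∈ Finset.range M, (D t).indicator 1 ω +
        ∑ k ∈ (competitive ν s ks)ᶜ, ∑ n ∈ Finset.range M, (V k n).indicator 1 ω)) := by
    intro ω hω
    have hpath := (hrun.isPath ω).card_running_le hs hK hb (fun t => confident_of_mem_goodEvent hω t)
      hτ0 hτ hT0 (fun T hT h => (tZero_spec hs hK hb h).2 T hT) M
    have hpath' := ENNReal.ofReal_le_ofReal hpath
    rw [ofReal_add_natCast_sum ha0 hT0] at hpath'
    rw [← hcount fun t ω => (σ t ω).Running, ← ENNReal.ofReal_natCast]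
    refine hpath'.trans (add_le_add le_rfl (add_le_add le_rfl (add_le_add ?_ ?_)))
    · rw [hcount fun t ω => Deviates ν s ks (t + 1) (σ t ω)]
      gcongr with t
      exact subset_toMeasurable _ _
    · refine Finset.sum_le_sum fun k _ => ?_
      rw [hcount fun n ω => ∃ t, (σ t ω).n ks = n + 1 ∧
        pseudoMean ν s k ks + gap ν ks ks / 2 ≤ (σ t ω).pseudoAvg k ks]
      gcongr with n
      exact subset_toMeasurable _ _
  have hDm : ∀ t, Measurable ((D t).indicator (1 : Ω → ENNReal)) := fun t =>
    measurable_one.indicator (measurableSet_toMeasurable _ _)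
  have hVm : ∀ k n, Measurable ((V k n).indicator (1 : Ω → ENNReal)) := fun k n =>
    measurable_one.indicator (measurableSet_toMeasurable _ _)
  have hDle : ∀ t, ∫⁻ ω in E, (D t).indicator 1 ω ∂P ≤
      P {ω | Deviates ν s ks (t + 1) (σ t ω)} := fun t => by
    rw [lintegral_indicator_one (measurableSet_toMeasurable _ _)]
    exact (Measure.restrict_apply_le _ _).trans_eq (measure_toMeasurable _)
  have hVle : ∀ k n, ∫⁻ ω in E, (V k n).indicator 1 ω ∂P ≤ P {ω | ∃ t, (σ t ω).n ks = n + 1 ∧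
      pseudoMean ν s k ks + gap ν ks ks / 2 ≤ (σ t ω).pseudoAvg k ks} := fun k n => by
    rw [lintegral_indicator_one (measurableSet_toMeasurable _ _)]
    exact (Measure.restrict_apply_le _ _).trans_eq (measure_toMeasurable _)
  calc ∑ t ∈ Finset.range M, P.restrict E {ω | (σ t ω).Running}
      = ∫⁻ ω in E, ∑ t ∈ Finset.range M, {ω | (σ t ω).Running}.indicator 1 ω ∂P := by
        rw [lintegral_finsetSum _ fun t _ => measurable_one.indicator (hR t)]
        exact Finset.sum_congr rfl fun t _ => (lintegral_indicator_one (hR t)).symm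
    _ ≤ _ := setLIntegral_mono' hE' hpoint
    _ = ENNReal.ofReal a * P E + (ENNReal.ofReal (tZero ν s ks) * P E +
        (3 * ∑ t ∈ Finset.range M, ∫⁻ ω in E, (D t).indicator 1 ω ∂P +
        ∑ k ∈ (competitive ν s ks)ᶜ, ∑ n ∈ Finset.range M,
          ∫⁻ ω in E, (V k n).indicator 1 ω ∂P)) := by
        rw [lintegral_add_left measurable_const, lintegral_add_left measurable_const,
          lintegral_add_left (by fun_prop), lintegral_const_mul _ (by fun_prop),
          lintegral_finsetSum _ fun t _ => hDm t, setLIntegral_const, setLIntegral_const,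
          lintegral_finsetSum _ fun k _ => by fun_prop]
        simp_rw [lintegral_finsetSum _ fun n _ => hVm _ n]
    _ ≤ ENNReal.ofReal a * P E + (ENNReal.ofReal (tZero ν s ks) * 1 +
        (3 * ENNReal.ofReal (3 * K) + ∑ k ∈ (competitive ν s ks)ᶜ,
          ENNReal.ofReal (1 / (2 * (gap ν ks ks / 2) ^ 2)))) := by
        gcongr with k
        · exact prob_le_one
        · exact (Finset.sum_le_sum fun t _ => hDle t).trans
            (sum_measure_deviates_le hs hrun ks M)
        · exact (Finset.sum_le_sum fun n _ => hVle k n).trans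
            (sum_measure_exists_eq_above_le hs hrun (by positivity) k ks M)
    _ = _ := by
        rw [mul_one, ← ENNReal.ofReal_sum_of_nonneg fun _ _ => by positivity,
          ← ENNReal.ofReal_ofNat, ← ENNReal.ofReal_mul (by norm_num),
          ← ENNReal.ofReal_add (by positivity) (by positivity),
          ← ENNReal.ofReal_add (by positivity) (by positivity)]
        congr 2
        ring

end Expectation

end CorrBandit

theorem theorem2 (c : ℝ) :
    ∃ ζ : ℝ, 0 < ζ ∧
      ∀ (B : ℕ → ℝ → ℝ), IsAnytimeBound B → HasLILRate c B →
      ∀ (K : ℕ), 2 ≤ K →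
      ∀ (ν : Measure (Fin K → ℝ)) [IsProbabilityMeasure ν] (s : Fin K → Fin K → ℝ → ℝ),
        CorrBandit.IsModel ν s →
      ∀ (ks : Fin K), CorrBandit.IsBest ν ks →
      ∀ (δ : ℝ), 0 < δ → δ < 1 →
      ∀ {Ω : Type*} [mΩ : MeasurableSpace Ω] (P : Measure Ω) [IsProbabilityMeasure P]
        (ℱ : Filtration ℕ mΩ) (m : ℕ → Ω → Fin K × Fin K) (X Y : ℕ → Ω → Fin K → ℝ),
        CorrBandit.IsCLUCBRun ν s B δ P ℱ m X Y →
        0 < P (CorrBandit.goodEvent ν s B δ ks m X Y) ∧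
        ∫⁻ ω, CorrBandit.numSamples s B δ m X Y ω
            ∂(ProbabilityTheory.cond P (CorrBandit.goodEvent ν s B δ ks m X Y)) ≤
          ENNReal.ofReal
            ((∑ k ∈ CorrBandit.competitive ν s ks,
                2 * ζ / (CorrBandit.gap ν ks k) ^ 2 *
                  Real.log (2 * K * max 1 (Real.log (1 / (CorrBandit.gap ν ks k) ^ 2)) / δ)) +
              (3 * K + 2 * K * CorrBandit.tZero ν s ks) / (1 - δ) +
              2 / (1 - δ) * (((K : ℝ) + 1) ^ 3 / CorrBandit.tZero ν s ks +
                2 / (CorrBandit.tZero ν s ks) ^ 2)) := by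
  refine ⟨2 * (64 * (64 * max |c| 1 ^ 2) ^ 2), by positivity, ?_⟩
  intro B hB hrate K hK ν _ s hs ks hb δ hδ hδ1 Ω mΩ P _ ℱ m X Y hrun
  have hK' : (2 : ℝ) ≤ K := by exact_mod_cast hK
  set E := CorrBandit.goodEvent ν s B δ ks m X Y with hE
  have hδ' : 0 < 1 - δ := by linarith
  have hPE : ENNReal.ofReal (1 - δ) ≤ P E :=
    CorrBandit.ofReal_one_sub_le_measure_goodEvent hK hs hrun hB hδ hδ1
  have hPE0 : 0 < P E := (ENNReal.ofReal_pos.2 hδ').trans_le hPE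
  refine ⟨hPE0, ?_⟩
  have hgap0 : ∀ k, 0 < CorrBandit.gap ν ks k := hb.gap_pos hK
  have hgap1 : ∀ k, CorrBandit.gap ν ks k ≤ 1 := hs.gap_le_one hK ks
  have hε : 0 < δ / (2 * K) := by positivity
  have hε1 : δ / (2 * K) ≤ 1 / 4 := by rw [div_le_div_iff₀ (by positivity) (by norm_num)]; linarith
  have hD : 4 ≤ 1 / (δ / (2 * K)) := by rw [le_div_iff₀ hε]; linarith
  let τ : Fin K → ℝ := fun k =>
    CorrBandit.enoughSamples c (1 / (δ / (2 * K))) (CorrBandit.gap ν ks k)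
  have hτ64 : ∀ k, 64 ≤ τ k := fun k =>
    CorrBandit.le_enoughSamples c hD (hgap0 k) (hgap1 k)
  have hτ0 : ∀ k, 0 ≤ τ k := fun k => by linarith [hτ64 k]
  have hτ : ∀ k (n : ℕ), τ k < n → B n (δ / (2 * K)) ≤ CorrBandit.gap ν ks k / 8 :=
    fun k n hn => CorrBandit.width_le_of_enoughSamples_lt hrate hε hε1 (hgap0 k) (hgap1 k) hn
  set a := ∑ k ∈ CorrBandit.competitive ν s ks, (τ k + 1) with ha
  set b := CorrBandit.tZero ν s ks + 9 * K +
    ∑ _k ∈ (CorrBandit.competitive ν s ks)ᶜ, 1 / (2 * (CorrBandit.gap ν ks ks / 2) ^ 2) with hb'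
  have hT0 := (CorrBandit.remainder_le (s := s) hs hK hb).1
  have hbrem := (CorrBandit.remainder_le (s := s) hs hK hb).2
  have ha0 : 0 ≤ a := Finset.sum_nonneg fun k _ => by linarith [hτ0 k]
  have hb0 : 0 ≤ b := add_nonneg (by positivity) (Finset.sum_nonneg fun k _ => by positivity)
  have hR : ∀ t, MeasurableSet {ω | (CorrBandit.randState s B δ m X Y t ω).Running} := fun t =>
    ((hrun.measurableState hs.measurable t).mono (ℱ.le t)).measurableSet_running
  have hN : ∫⁻ ω in E, CorrBandit.numSamples s B δ m X Y ω ∂P ≤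
      2 * (ENNReal.ofReal a * P E + ENNReal.ofReal b) := by
    have hterm : ∀ t ω, {t : ℕ | (CorrBandit.randState s B δ m X Y t ω).Running}.indicator
        (fun _ => (2 : ENNReal)) t = {ω | (CorrBandit.randState s B δ m X Y t ω).Running}.indicator
          (fun _ => 2) ω := fun t ω => rfl
    simp only [CorrBandit.numSamples, hterm]
    rw [lintegral_tsum fun t => (measurable_const.indicator (hR t)).aemeasurable]
    refine ENNReal.tsum_le_of_sum_range_le fun M => ?_
    rw [Finset.sum_congr rfl fun t _ => lintegral_indicator_const (hR t) 2, ← Finset.mul_sum]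
    gcongr
    exact CorrBandit.sum_measure_running_le hK hs hb hrun hτ0 hτ M
  calc ∫⁻ ω, CorrBandit.numSamples s B δ m X Y ω ∂(ProbabilityTheory.cond P E)
      = (P E)⁻¹ * ∫⁻ ω in E, CorrBandit.numSamples s B δ m X Y ω ∂P := by
        rw [ProbabilityTheory.cond, lintegral_smul_measure, smul_eq_mul]
    _ ≤ (P E)⁻¹ * (2 * (ENNReal.ofReal a * P E + ENNReal.ofReal b)) := by gcongr
    _ = 2 * ENNReal.ofReal a * ((P E)⁻¹ * P E) + 2 * ENNReal.ofReal b * (P E)⁻¹ := by ring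
    _ ≤ 2 * ENNReal.ofReal a * 1 + 2 * ENNReal.ofReal b * (ENNReal.ofReal (1 - δ))⁻¹ := by
        gcongr
        exact ENNReal.inv_mul_le_one _
    _ = ENNReal.ofReal (2 * a + 2 * b * (1 - δ)⁻¹) := by
        rw [← ENNReal.ofReal_inv_of_pos hδ', mul_one, ← ENNReal.ofReal_ofNat,
          ← ENNReal.ofReal_mul (by norm_num), ← ENNReal.ofReal_mul (by norm_num),
          ← ENNReal.ofReal_mul (by positivity), ← ENNReal.ofReal_add (by positivity)
            (by positivity)]
    _ ≤ _ := by
        refine ENNReal.ofReal_le_ofReal ?_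
        rw [add_assoc]
        refine add_le_add ?_ ?_
        · rw [ha, Finset.mul_sum]
          refine Finset.sum_le_sum fun k _ => ?_
          have h1 : 2 * (2 * (64 * (64 * max |c| 1 ^ 2) ^ 2)) / CorrBandit.gap ν ks k ^ 2 *
              Real.log (2 * K * max 1 (Real.log (1 / CorrBandit.gap ν ks k ^ 2)) / δ) =
              4 * τ k := by
            have h2 : 2 * K * max 1 (Real.log (1 / CorrBandit.gap ν ks k ^ 2)) / δ =
              1 / (δ / (2 * K)) * max 1 (Real.log (1 / CorrBandit.gap ν ks k ^ 2)) := by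
                rw [one_div_div]; ring
            rw [h2]
            simp only [τ, CorrBandit.enoughSamples]
            ring
          rw [h1]
          linarith [hτ64 k]
        · calc 2 * b * (1 - δ)⁻¹ ≤ 2 * ((3 * K + 2 * K * CorrBandit.tZero ν s ks) / 2 +
                (((K : ℝ) + 1) ^ 3 / CorrBandit.tZero ν s ks +
                  2 / CorrBandit.tZero ν s ks ^ 2)) * (1 - δ)⁻¹ := by gcongr
            _ = _ := by
                field_simp
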